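/- Let $G$ be a compact Hausdorff group with normalized (Radon) Haar measure $m_G$. Let $\Phi:[0,\infty)\to[0,\infty)$ be a Young function (convex, $\Phi(0)=0$, $\Phi(x)\to\infty$ as $x\to\infty$) with complementary function $\Psi(y)=\sup_{x\ge 0}(xy-\Phi(x))\in[0,\infty]$, and assume that $\Phi$ and $\Psi$ both satisfy the $\Delta_2$-condition: there are $K,x_0>0$ with $\Phi(2x)\le K\Phi(x)$ for all $x\ge x_0$, and similarly for $\Psi$. Let $L^\Phi(G)$ be the Orlicz space of (classes of) complex measurable functions $f$ on $G$ with $\|f\|_\Phi=\inf\{k>0:\int_G\Phi(|f|/k)\,dm_G\le 1\}<\infty$. Let $\mu$ be a complex Radon measure on $G$ with $\mu(G)\ne 0$, and put $(\mu*f)(t)=\int_G f(s^{-1}t)\,d\mu(s)$. For a vector measure $\nu$ on the Borel sets of $G$ with values in a complex normed space $X$, and $x'\in X'$, let $\langle\nu,x'\rangle(A)=\langle\nu(A),x'\rangle$. A function $f:G\to\mathbb C$ belongs to $L^1(\nu)$ if $f\in L^1(|\langle\nu,x'\rangle|)$ for all $x'\in X'$ and for each Borel set $A$ there is a unique $x_A\in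 X$ with $\int_A f\,d\langle\nu,x'\rangle=\langle x_A,x'\rangle$ for all $x'\in X'$; then $I_\nu(f)=\int_G f\,d\nu:=x_G$, and $\|f\|_\nu=\sup_{\|x'\|\le 1}\int_G|f|\,d|\langle\nu,x'\rangle|$. Then $f\mapsto\mu*f$ (the integral converges absolutely for almost every $t$) is a bounded linear operator $T_{\Phi,\mu}:L^\Phi(G)\to L^\Phi(G)$, and $\nu=\nu_{\Phi,\mu}:A\mapsto T_{\Phi,\mu}(\chi_A)$ is an $L^\Phi(G)$-valued ($\sigma$-additive) vector measure with the same null sets as $m_G$. Moreover $\|f\|_\nu<\infty$ for all $f\in L^1(\nu)$, and: (1) $L^\Phi(G)\subseteq L^1(\nu)$, and $L^\Phi(G)$ is dense in the optimal domain $L^1(\nu)$ with respect to $\|\cdot\|_\nu$. (2) The integration operator $I_\nu:L^1(\nu)\to L^\Phi(G)$ extends $T_{\Phi,\mu}$, satisfies $\|I_\nu(f)\|_\Phi\le\|f\|_\nu$, and is given by convolution: for every $f\in L^1(\nu)$ the integral defining $(\mu*f)(t)$ converges absolutely for almost every $t\in G$, and $I_\nu(f)=\mu*f$ almost everywhere.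 -/

import Mathlib

open MeasureTheory Filter Topology
open scoped NNReal ENNReal

noncomputable section

namespace OrliczConv

/-- A Young function: a convex function with value `0` at `0` that tends to `∞` at `∞`.
Its value at the point `∞` is never used, so it is a function of a finite variable; it may take
the value `∞`. -/
structure YoungFunction where
  toFun : ℝ≥0 → ℝ≥0∞
  convex' : ConvexOn ℝ≥0 Set.univ toFun
  zero' : toFun 0 = 0
  tendsto' : Tendsto toFun atTop (𝓝 ⊤)

instance : CoeFun YoungFunction (fun _ => ℝ≥0 → ℝ≥0∞) := ⟨YoungFunction.toFun⟩

/-- The complementary function `Ψ(y) = sup {x y - Φ(x) : x ≥ 0}`. The subtraction of `ℝ≥0∞` is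
truncated at `0`, which does not change the supremum as `x = 0` contributes `0`. -/
def complementary (Φ : ℝ≥0 → ℝ≥0∞) (y : ℝ≥0) : ℝ≥0∞ :=
  ⨆ x : ℝ≥0, ((x : ℝ≥0∞) * (y : ℝ≥0∞) - Φ x)

/-- The `Δ₂`-condition (for large arguments). -/
def DeltaTwo (Φ : ℝ≥0 → ℝ≥0∞) : Prop :=
  ∃ K x₀ : ℝ≥0, 0 < K ∧ 0 < x₀ ∧ ∀ x : ℝ≥0, x₀ ≤ x → Φ (2 * x) ≤ (K : ℝ≥0∞) * Φ x

theorem YoungFunction.convex_le (Φ : YoungFunction) {a b x y : ℝ≥0} (hab : a + b = 1) :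
    Φ (a * x + b * y) ≤ (a : ℝ≥0∞) * Φ x + (b : ℝ≥0∞) * Φ y := by
  have h := Φ.convex'.2 (Set.mem_univ x) (Set.mem_univ y) (zero_le (a := a)) (zero_le (a := b)) hab
  simpa [ENNReal.smul_def] using h

theorem YoungFunction.mono (Φ : YoungFunction) : Monotone Φ.toFun := by
  intro x y hxy
  rcases eq_or_ne y 0 with rfl | hy
  · have : x = 0 := le_antisymm hxy zero_le
    rw [this]
  have h1 : x / y ≤ 1 := div_le_one_of_le₀ hxy zero_le
  have h := Φ.convex_le (a := x / y) (b := 1 - x / y) (x := y) (y := 0)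
    (add_tsub_cancel_of_le h1)
  rw [Φ.zero', mul_zero, mul_zero, add_zero, add_zero, div_mul_cancel₀ _ hy] at h
  refine h.trans ?_
  calc ((x / y : ℝ≥0) : ℝ≥0∞) * Φ y ≤ 1 * Φ y := by
        gcongr
        exact_mod_cast h1
    _ = Φ y := one_mul _

section Orlicz

variable {α : Type*} [MeasurableSpace α]

/-- The set of all `k > 0` with `∫ Φ(|f| / k) dm ≤ 1`. -/
def luxSet (Φ : YoungFunction) (m : Measure α) (f : α → ℂ) : Set ℝ≥0 :=
  {k | 0 < k ∧ ∫⁻ x, Φ (‖f x‖₊ / k) ∂m ≤ 1}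

theorem luxSet_congr (Φ : YoungFunction) {m : Measure α} {f g : α → ℂ} (h : f =ᵐ[m] g) :
    luxSet Φ m f = luxSet Φ m g := by
  ext k
  have : ∫⁻ x, Φ (‖f x‖₊ / k) ∂m = ∫⁻ x, Φ (‖g x‖₊ / k) ∂m :=
    lintegral_congr_ae (h.mono fun x hx => by simp only [hx])
  simp only [luxSet, Set.mem_ofPred_eq, this]

theorem mem_luxSet_add (Φ : YoungFunction) {m : Measure α} {f g : α → ℂ}
    (hf : AEStronglyMeasurable f m) {k l : ℝ≥0}
    (hk : k ∈ luxSet Φ m f) (hl : l ∈ luxSet Φ m g) : k + l ∈ luxSet Φ m (f + g) := by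
  obtain ⟨hk0, hk1⟩ := hk
  obtain ⟨hl0, hl1⟩ := hl
  have hs : 0 < k + l := add_pos hk0 hl0
  have hab : k / (k + l) + l / (k + l) = 1 := by
    rw [← add_div, div_self hs.ne']
  refine ⟨hs, ?_⟩
  have hmeas : AEMeasurable (fun x => ((k / (k + l) : ℝ≥0) : ℝ≥0∞) * Φ (‖f x‖₊ / k)) m := by
    have : AEMeasurable (fun x => ‖f x‖₊ / k) m := by
      have := hf.aemeasurable.nnnorm
      exact this.div_const k
    exact (Φ.mono.measurable.comp_aemeasurable this).const_mul _
  calc ∫⁻ x, Φ (‖(f + g) x‖₊ / (k + l)) ∂m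
      ≤ ∫⁻ x, (((k / (k + l) : ℝ≥0) : ℝ≥0∞) * Φ (‖f x‖₊ / k)
          + ((l / (k + l) : ℝ≥0) : ℝ≥0∞) * Φ (‖g x‖₊ / l)) ∂m := by
        refine lintegral_mono fun x => ?_
        refine le_trans (Φ.mono ?_) (Φ.convex_le hab)
        calc ‖(f + g) x‖₊ / (k + l) ≤ (‖f x‖₊ + ‖g x‖₊) / (k + l) := by
              gcongr
              exact nnnorm_add_le _ _
          _ = k / (k + l) * (‖f x‖₊ / k) + l / (k + l) * (‖g x‖₊ / l) := by
              have := hk0.ne'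
              have := hl0.ne'
              have := hs.ne'
              field_simp
    _ = ((k / (k + l) : ℝ≥0) : ℝ≥0∞) * ∫⁻ x, Φ (‖f x‖₊ / k) ∂m
          + ((l / (k + l) : ℝ≥0) : ℝ≥0∞) * ∫⁻ x, Φ (‖g x‖₊ / l) ∂m := by
        rw [lintegral_add_left' hmeas, lintegral_const_mul' _ _ ENNReal.coe_ne_top,
          lintegral_const_mul' _ _ ENNReal.coe_ne_top]
    _ ≤ ((k / (k + l) : ℝ≥0) : ℝ≥0∞) * 1 + ((l / (k + l) : ℝ≥0) : ℝ≥0∞) * 1 := by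
        gcongr
    _ = 1 := by
        rw [mul_one, mul_one, ← ENNReal.coe_add, hab, ENNReal.coe_one]

theorem mem_luxSet_smul (Φ : YoungFunction) {m : Measure α} {f : α → ℂ} {c : ℂ} (hc : c ≠ 0)
    {k : ℝ≥0} (hk : k ∈ luxSet Φ m f) : ‖c‖₊ * k ∈ luxSet Φ m (c • f) := by
  have hc' : 0 < ‖c‖₊ := nnnorm_pos.2 hc
  refine ⟨mul_pos hc' hk.1, ?_⟩
  have : ∀ x, ‖(c • f) x‖₊ / (‖c‖₊ * k) = ‖f x‖₊ / k := fun x => by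
    rw [Pi.smul_apply, nnnorm_smul, mul_div_mul_left _ _ hc'.ne']
  simpa only [this] using hk.2

theorem mem_luxSet_zero (Φ : YoungFunction) (m : Measure α) {k : ℝ≥0} (hk : 0 < k) :
    k ∈ luxSet Φ m 0 := by
  refine ⟨hk, ?_⟩
  simp [Φ.zero']

/-- The Orlicz space `L^Φ(m)` of classes of complex measurable functions with
`∫ Φ(|f| / k) dm ≤ 1` for some `k > 0`. -/
def OrliczSpace (Φ : YoungFunction) (m : Measure α) : Submodule ℂ (α →ₘ[m] ℂ) where
  carrier := {f | (luxSet Φ m f).Nonempty}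
  zero_mem' := ⟨1, by
    rw [luxSet_congr Φ (AEEqFun.coeFn_zero)]
    exact mem_luxSet_zero Φ m one_pos⟩
  add_mem' := by
    rintro f g ⟨k, hk⟩ ⟨l, hl⟩
    refine ⟨k + l, ?_⟩
    rw [luxSet_congr Φ (AEEqFun.coeFn_add f g)]
    exact mem_luxSet_add Φ f.aestronglyMeasurable hk hl
  smul_mem' := by
    rintro c f ⟨k, hk⟩
    rcases eq_or_ne c 0 with rfl | hc
    · refine ⟨1, ?_⟩
      rw [zero_smul, luxSet_congr Φ (AEEqFun.coeFn_zero)]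
      exact mem_luxSet_zero Φ m one_pos
    · refine ⟨‖c‖₊ * k, ?_⟩
      rw [luxSet_congr Φ (AEEqFun.coeFn_smul c f)]
      exact mem_luxSet_smul Φ hc hk

/-- The Luxemburg norm `inf {k > 0 : ∫ Φ(|f| / k) dm ≤ 1}`. -/
def luxNorm (Φ : YoungFunction) (m : Measure α) (f : α → ℂ) : ℝ≥0 := sInf (luxSet Φ m f)

instance (Φ : YoungFunction) (m : Measure α) : Norm (OrliczSpace Φ m) :=
  ⟨fun f => (luxNorm Φ m f.1 : ℝ)⟩

theorem OrliczSpace.norm_def (Φ : YoungFunction) (m : Measure α) (f : OrliczSpace Φ m) :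
    ‖f‖ = (sInf (luxSet Φ m (f.1 : α → ℂ)) : ℝ≥0) := rfl

theorem luxNorm_smul_le (Φ : YoungFunction) (m : Measure α) (c : ℂ) (hc : c ≠ 0)
    (f : OrliczSpace Φ m) : ‖c • f‖ ≤ ‖c‖ * ‖f‖ := by
  rw [OrliczSpace.norm_def, OrliczSpace.norm_def, ← coe_nnnorm, ← NNReal.coe_mul,
    NNReal.coe_le_coe]
  have hc' : 0 < ‖c‖₊ := nnnorm_pos.2 hc
  have h : luxSet Φ m ((c • f : OrliczSpace Φ m).1 : α → ℂ) = luxSet Φ m (c • (f.1 : α → ℂ)) :=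
    luxSet_congr Φ (AEEqFun.coeFn_smul c f.1)
  rw [h, mul_comm, ← div_le_iff₀ hc']
  refine le_csInf f.2 fun k hk => ?_
  rw [div_le_iff₀ hc', mul_comm]
  exact csInf_le (OrderBot.bddBelow _) (mem_luxSet_smul Φ hc hk)

theorem OrliczSpace.norm_zero' (Φ : YoungFunction) (m : Measure α) :
    ‖(0 : OrliczSpace Φ m)‖ = 0 := by
  rw [OrliczSpace.norm_def, NNReal.coe_eq_zero]
  refine le_antisymm (le_of_forall_pos_le_add fun ε hε => ?_) zero_le
  rw [zero_add]
  refine csInf_le (OrderBot.bddBelow _) ?_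
  have h : luxSet Φ m ((0 : OrliczSpace Φ m).1 : α → ℂ) = luxSet Φ m 0 :=
    luxSet_congr Φ AEEqFun.coeFn_zero
  rw [h]
  exact mem_luxSet_zero Φ m hε

theorem ae_zero_of_luxNorm (Φ : YoungFunction) {m : Measure α} {f : α → ℂ}
    (hf : AEStronglyMeasurable f m) (hne : (luxSet Φ m f).Nonempty)
    (h : sInf (luxSet Φ m f) = 0) : f =ᵐ[m] 0 := by
  have key : ∀ k : ℝ≥0, 0 < k → ∫⁻ x, Φ (‖f x‖₊ / k) ∂m ≤ 1 := by
    intro k hk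
    obtain ⟨l, hl, hlk⟩ := exists_lt_of_csInf_lt hne (h ▸ hk)
    refine le_trans (lintegral_mono fun x => Φ.mono ?_) hl.2
    have := hl.1
    gcongr
  have hn : ∀ n : ℕ, m {x | ((1 : ℝ≥0) / (n + 1)) ≤ ‖f x‖₊} = 0 := by
    intro n
    set δ : ℝ≥0 := 1 / (n + 1) with hδ
    have hδ0 : 0 < δ := by positivity
    by_contra hne0
    have hlim : Tendsto (fun t : ℝ≥0 => Φ (δ * t)) atTop (𝓝 ⊤) :=
      Φ.tendsto'.comp (tendsto_id.const_mul_atTop hδ0)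
    have hlim2 : Tendsto (fun t : ℝ≥0 => Φ (δ * t) * m {x | δ ≤ ‖f x‖₊}) atTop (𝓝 ⊤) := by
      have := ENNReal.Tendsto.mul_const (b := m {x | δ ≤ ‖f x‖₊}) hlim
        (Or.inl ENNReal.top_ne_zero)
      rwa [ENNReal.top_mul hne0] at this
    have hev := (hlim2.eventually (lt_mem_nhds ENNReal.one_lt_top)).and (eventually_gt_atTop 0)
    obtain ⟨t, ht1, ht0⟩ := hev.exists
    refine absurd (key t⁻¹ (inv_pos.2 ht0)) (not_le.2 (lt_of_lt_of_le ht1 ?_))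
    have hms : NullMeasurableSet {x | δ ≤ ‖f x‖₊} m :=
      nullMeasurableSet_le aemeasurable_const hf.aemeasurable.nnnorm
    calc Φ (δ * t) * m {x | δ ≤ ‖f x‖₊}
        = ∫⁻ _ in {x | δ ≤ ‖f x‖₊}, Φ (δ * t) ∂m := by rw [setLIntegral_const]
      _ ≤ ∫⁻ x in {x | δ ≤ ‖f x‖₊}, Φ (‖f x‖₊ / t⁻¹) ∂m := by
          refine lintegral_mono_ae ?_
          filter_upwards [ae_restrict_mem₀ hms] with x hx
          refine Φ.mono ?_
          rw [div_inv_eq_mul]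
          have : δ ≤ ‖f x‖₊ := hx
          gcongr
      _ ≤ ∫⁻ x, Φ (‖f x‖₊ / t⁻¹) ∂m := setLIntegral_le_lintegral _ _
  have hall : ∀ᵐ x ∂m, ∀ n : ℕ, ¬ ((1 : ℝ≥0) / (n + 1)) ≤ ‖f x‖₊ := by
    rw [ae_all_iff]
    intro n
    rw [ae_iff]
    simpa only [not_not] using hn n
  filter_upwards [hall] with x hx
  by_contra hx0
  have hpos : 0 < ‖f x‖₊ := nnnorm_pos.2 hx0
  obtain ⟨n, hn⟩ := exists_nat_one_div_lt (K := ℝ≥0) hpos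
  exact hx n hn.le

theorem OrliczSpace.core (Φ : YoungFunction) (m : Measure α) :
    NormedSpace.Core ℂ (OrliczSpace Φ m) where
  norm_nonneg f := NNReal.coe_nonneg _
  norm_smul c f := by
    rcases eq_or_ne c 0 with rfl | hc
    · rw [zero_smul, OrliczSpace.norm_zero', norm_zero, zero_mul]
    refine le_antisymm (luxNorm_smul_le Φ m c hc f) ?_
    have h := luxNorm_smul_le Φ m c⁻¹ (inv_ne_zero hc) (c • f)
    rw [inv_smul_smul₀ hc, norm_inv] at h
    rwa [← le_inv_mul_iff₀ (norm_pos_iff.2 hc)]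
  norm_triangle f g := by
    rw [OrliczSpace.norm_def, OrliczSpace.norm_def, OrliczSpace.norm_def, ← NNReal.coe_add,
      NNReal.coe_le_coe]
    have h : luxSet Φ m ((f + g : OrliczSpace Φ m).1 : α → ℂ)
        = luxSet Φ m ((f.1 : α → ℂ) + (g.1 : α → ℂ)) :=
      luxSet_congr Φ (AEEqFun.coeFn_add f.1 g.1)
    rw [h]
    refine le_of_forall_pos_le_add fun ε hε => ?_
    obtain ⟨k, hk, hk'⟩ := exists_lt_of_csInf_lt f.2
      (lt_add_of_pos_right (sInf (luxSet Φ m (f.1 : α → ℂ))) (half_pos hε))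
    obtain ⟨l, hl, hl'⟩ := exists_lt_of_csInf_lt g.2
      (lt_add_of_pos_right (sInf (luxSet Φ m (g.1 : α → ℂ))) (half_pos hε))
    calc sInf (luxSet Φ m ((f.1 : α → ℂ) + (g.1 : α → ℂ))) ≤ k + l :=
          csInf_le (OrderBot.bddBelow _) (mem_luxSet_add Φ f.1.aestronglyMeasurable hk hl)
      _ ≤ (sInf (luxSet Φ m (f.1 : α → ℂ)) + ε / 2)
            + (sInf (luxSet Φ m (g.1 : α → ℂ)) + ε / 2) := add_le_add hk'.le hl'.le
      _ = sInf (luxSet Φ m (f.1 : α → ℂ)) + sInf (luxSet Φ m (g.1 : α → ℂ)) + ε := by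
          rw [add_add_add_comm, add_halves]
  norm_eq_zero_iff f := by
    refine ⟨fun h => ?_, fun h => by rw [h, OrliczSpace.norm_zero']⟩
    rw [OrliczSpace.norm_def, NNReal.coe_eq_zero] at h
    have h0 := ae_zero_of_luxNorm Φ f.1.aestronglyMeasurable f.2 h
    exact Subtype.ext (AEEqFun.ext (h0.trans AEEqFun.coeFn_zero.symm))

instance (Φ : YoungFunction) (m : Measure α) : NormedAddCommGroup (OrliczSpace Φ m) :=
  NormedAddCommGroup.ofCore (OrliczSpace.core Φ m)

instance (Φ : YoungFunction) (m : Measure α) : NormedSpace ℂ (OrliczSpace Φ m) :=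
  NormedSpace.ofCore (OrliczSpace.core Φ m)

end Orlicz

section VectorMeasure

variable {α : Type*} [MeasurableSpace α] {X : Type*} [NormedAddCommGroup X] [NormedSpace ℂ X]

/-- The complex measure `⟨ν, x'⟩ : A ↦ x'(ν(A))`. -/
def pairing (ν : VectorMeasure α X) (x' : StrongDual ℂ X) : ComplexMeasure α :=
  ν.mapRange (x' : X →ₗ[ℂ] ℂ).toAddMonoidHom x'.continuous

/-- `A` is `ν`-null if `ν` vanishes on all measurable subsets of `A`. -/
def IsNull (ν : VectorMeasure α X) (A : Set α) : Prop :=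
  ∀ B, MeasurableSet B → B ⊆ A → ν B = 0

/-- The integral of a complex function with respect to a complex measure. -/
def cintegral (μ : ComplexMeasure α) (f : α → ℂ) : ℂ :=
  μ.integral f (ContinuousLinearMap.mul ℝ ℂ)

/-- `f` is `ν`-weakly integrable: `f ∈ L¹(|⟨ν, x'⟩|)` for all `x'` in the dual. -/
def WeaklyIntegrable (ν : VectorMeasure α X) (f : α → ℂ) : Prop :=
  ∀ x' : StrongDual ℂ X, Integrable f (pairing ν x').variation

/-- `x` is the integral of `f` over `A` with respect to `ν`:
`∫_A f d⟨ν, x'⟩ = ⟨x, x'⟩` for all `x'` in the dual. -/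
def HasVectorIntegral (ν : VectorMeasure α X) (f : α → ℂ) (A : Set α) (x : X) : Prop :=
  ∀ x' : StrongDual ℂ X, cintegral ((pairing ν x').restrict A) f = x' x

/-- `f` is `ν`-integrable, i.e. `f` belongs to `L¹(ν)`. -/
def MemL1 (ν : VectorMeasure α X) (f : α → ℂ) : Prop :=
  WeaklyIntegrable ν f ∧ ∀ A, MeasurableSet A → ∃! x : X, HasVectorIntegral ν f A x

/-- The norm of `L¹(ν)`: the supremum of `∫ |f| d|⟨ν, x'⟩|` over the closed unit ball of the
dual. -/
def vnorm (ν : VectorMeasure α X) (f : α → ℂ) : ℝ≥0∞ :=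
  ⨆ (x' : StrongDual ℂ X) (_ : ‖x'‖ ≤ 1), ∫⁻ t, ‖f t‖ₑ ∂(pairing ν x').variation

open Classical in
/-- The integration operator `I_ν(f) = ∫ f dν` (with the value `0` off `L¹(ν)`). -/
def integrationOp (ν : VectorMeasure α X) (f : α → ℂ) : X :=
  if h : MemL1 ν f then (h.2 Set.univ MeasurableSet.univ).choose else 0

end VectorMeasure

/-- The convolution `(μ * f)(t) = ∫ f(s⁻¹ t) dμ(s)`. -/
def conv {G : Type*} [Group G] [MeasurableSpace G] (μ : ComplexMeasure G) (f : G → ℂ) (t : G) :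
    ℂ :=
  cintegral μ fun s => f (s⁻¹ * t)

end OrliczConv

end

set_option linter.overlappingInstances false

/-! Finiteness of `Φ` and its `Δ₂`-condition make the modular of `f / ε` finite for every `ε > 0` as
soon as `f` lies in `L^Φ`. Hence dominated convergence and absolute continuity hold in the Luxemburg
norm, and `A ↦ T χ_A` is countably additive for each bounded operator `T`. Approximation by simple
functions then gives `L^Φ ⊆ L¹(ν)` and `I_ν = T` on `L^Φ`. For `T f = μ * f`, boundedness follows
from Jensen's inequality for the normalized measure `|μ|` and from translation invariance
(`mem_luxSet_conv`).

Convolution multiplies Haar integrals by `μ(G)`. The functional `u ↦ ∫ u dm` therefore sends `ν` to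
`μ(G) m`. As `μ(G) ≠ 0`, this identifies the null sets and forces `L¹(ν) ⊆ L¹(m)`
(`integrable_of_memL1`). For `f ∈ L¹(ν)` the truncations of `f` lie in `L^Φ`. Testing them against
the functionals `u ↦ ∫_B u dm` and passing to the limit gives `I_ν(f) = μ * f`.

For density it must be shown that `f χ_{|f|>n}` tends to `0` in `L¹(ν)`. Up to a factor `4` its norm
is the supremum over `A ⊆ {|f|>n}` of the Luxemburg norms of `μ * (f χ_A)`. These functions depend
additively on `A` and tend to `0` in `L¹(m)` uniformly in `A`; a gliding hump argument
(`exists_forall_eLux_le`) upgrades this to uniform convergence in the Luxemburg norm.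

`G` need not be metrizable, so `(s, t) ↦ f(s⁻¹ t)` may fail to be measurable for the product of the
Borel `σ`-algebras. Fubini's theorem is used for continuous functions only; the passage to
integrable ones rests on regularity (`ae_ae_translates`) and on rapid `L¹`-approximation
(`ae_tendsto_translates`). -/

noncomputable section

namespace OrliczConv

/-! ### The Luxemburg gauge on arbitrary functions and classes in the Orlicz space. -/

section LuxemburgGauge

variable {α : Type*} [MeasurableSpace α]

/-- The Luxemburg gauge with values in `[0, ∞]`, defined for all functions. -/
def eLux (Φ : YoungFunction) (m : Measure α) (f : α → ℂ) : ℝ≥0∞ :=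
  ⨅ k ∈ luxSet Φ m f, (k : ℝ≥0∞)

variable {Φ : YoungFunction} {m : Measure α} {f g : α → ℂ}

theorem eLux_le {k : ℝ≥0} (hk : k ∈ luxSet Φ m f) : eLux Φ m f ≤ k := iInf₂_le k hk

theorem exists_mem_luxSet_of_eLux_lt {c : ℝ≥0∞} (h : eLux Φ m f < c) :
    ∃ k ∈ luxSet Φ m f, (k : ℝ≥0∞) < c := by
  simpa only [eLux, iInf_lt_iff, exists_prop] using h

theorem eLux_lt_top_iff : eLux Φ m f < ⊤ ↔ (luxSet Φ m f).Nonempty := by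
  refine ⟨fun h => ?_, fun ⟨k, hk⟩ => (eLux_le hk).trans_lt ENNReal.coe_lt_top⟩
  obtain ⟨k, hk, -⟩ := exists_mem_luxSet_of_eLux_lt h
  exact ⟨k, hk⟩

theorem luxSet_subset_of_norm_le (h : ∀ᵐ x ∂m, ‖f x‖ ≤ ‖g x‖) :
    luxSet Φ m g ⊆ luxSet Φ m f := by
  refine fun k hk => ⟨hk.1, (lintegral_mono_ae ?_).trans hk.2⟩
  filter_upwards [h] with x hx
  refine Φ.mono ?_
  have : ‖f x‖₊ ≤ ‖g x‖₊ := hx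
  gcongr

theorem eLux_mono (h : ∀ᵐ x ∂m, ‖f x‖ ≤ ‖g x‖) : eLux Φ m f ≤ eLux Φ m g :=
  le_iInf₂ fun _ hk => eLux_le (luxSet_subset_of_norm_le h hk)

theorem eLux_congr (h : f =ᵐ[m] g) : eLux Φ m f = eLux Φ m g := by
  rw [eLux, eLux, luxSet_congr Φ h]

theorem eLux_zero : eLux Φ m (0 : α → ℂ) = 0 := by
  refine le_antisymm (le_of_forall_gt fun c hc => ?_) zero_le
  obtain ⟨k, hk0, hkc⟩ := ENNReal.lt_iff_exists_nnreal_btwn.1 hc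
  exact (eLux_le (mem_luxSet_zero Φ m (by exact_mod_cast hk0))).trans_lt hkc

theorem eLux_add_le (hf : AEStronglyMeasurable f m) :
    eLux Φ m (f + g) ≤ eLux Φ m f + eLux Φ m g := by
  refine ENNReal.le_of_forall_pos_le_add fun ε hε hlt => ?_
  have hε2 : ((ε / 2 : ℝ≥0) : ℝ≥0∞) ≠ 0 := by simpa using hε.ne'
  have htop := ENNReal.add_lt_top.1 hlt
  obtain ⟨k, hk, hka⟩ := exists_mem_luxSet_of_eLux_lt (ENNReal.lt_add_right htop.1.ne hε2)
  obtain ⟨l, hl, hlb⟩ := exists_mem_luxSet_of_eLux_lt (ENNReal.lt_add_right htop.2.ne hε2)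
  refine (eLux_le (mem_luxSet_add Φ hf hk hl)).trans ?_
  calc ((k + l : ℝ≥0) : ℝ≥0∞) = k + l := ENNReal.coe_add _ _
    _ ≤ (eLux Φ m f + ((ε / 2 : ℝ≥0) : ℝ≥0∞)) + (eLux Φ m g + ((ε / 2 : ℝ≥0) : ℝ≥0∞)) :=
      add_le_add hka.le hlb.le
    _ = eLux Φ m f + eLux Φ m g + ε := by
      rw [add_add_add_comm, ← ENNReal.coe_add, add_halves]

theorem enorm_eq_eLux (f : OrliczSpace Φ m) : ‖f‖ₑ = eLux Φ m (f : α →ₘ[m] ℂ) := by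
  have h : ‖f‖ₑ = (sInf (luxSet Φ m ((f : α →ₘ[m] ℂ) : α → ℂ)) : ℝ≥0) := by
    rw [← ofReal_norm, OrliczSpace.norm_def, ENNReal.ofReal_coe_nnreal]
  rw [h, eLux, ← sInf_image, sInf_image, ENNReal.coe_sInf f.2]

theorem eLux_coe_lt_top (f : OrliczSpace Φ m) : eLux Φ m (f : α →ₘ[m] ℂ) < ⊤ :=
  eLux_lt_top_iff.2 f.2

open Classical in
/-- The class of a function in the Orlicz space (with the value `0` if there is none). -/
def ofFun (Φ : YoungFunction) (m : Measure α) (f : α → ℂ) : OrliczSpace Φ m :=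
  if h : AEStronglyMeasurable f m ∧ eLux Φ m f < ⊤ then
    ⟨AEEqFun.mk f h.1, by
      change (luxSet Φ m (AEEqFun.mk f h.1)).Nonempty
      rw [luxSet_congr Φ (AEEqFun.coeFn_mk f h.1)]
      exact eLux_lt_top_iff.1 h.2⟩
  else 0

theorem coe_ofFun (hf : AEStronglyMeasurable f m) (h : eLux Φ m f < ⊤) :
    ((ofFun Φ m f : OrliczSpace Φ m) : α →ₘ[m] ℂ) =ᵐ[m] f := by
  rw [ofFun, dif_pos ⟨hf, h⟩]
  exact AEEqFun.coeFn_mk f hf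

theorem eq_of_coe_ae_eq {u v : OrliczSpace Φ m}
    (h : ((u : α →ₘ[m] ℂ) : α → ℂ) =ᵐ[m] (v : α →ₘ[m] ℂ)) : u = v :=
  Subtype.ext (AEEqFun.ext h)

theorem eq_ofFun {u : OrliczSpace Φ m} (h : ((u : α →ₘ[m] ℂ) : α → ℂ) =ᵐ[m] f) :
    u = ofFun Φ m f :=
  eq_of_coe_ae_eq (h.trans (coe_ofFun ((u : α →ₘ[m] ℂ).aestronglyMeasurable.congr h)
    (eLux_congr (Φ := Φ) h ▸ eLux_coe_lt_top u)).symm)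

theorem coe_add_ae (u v : OrliczSpace Φ m) :
    (((u + v : OrliczSpace Φ m) : α →ₘ[m] ℂ) : α → ℂ) =ᵐ[m]
      fun x => (u : α →ₘ[m] ℂ) x + (v : α →ₘ[m] ℂ) x := AEEqFun.coeFn_add u.1 v.1

theorem coe_sub_ae (u v : OrliczSpace Φ m) :
    (((u - v : OrliczSpace Φ m) : α →ₘ[m] ℂ) : α → ℂ) =ᵐ[m]
      fun x => (u : α →ₘ[m] ℂ) x - (v : α →ₘ[m] ℂ) x := AEEqFun.coeFn_sub u.1 v.1

theorem coe_smul_ae (c : ℂ) (u : OrliczSpace Φ m) :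
    (((c • u : OrliczSpace Φ m) : α →ₘ[m] ℂ) : α → ℂ) =ᵐ[m]
      fun x => c * (u : α →ₘ[m] ℂ) x := AEEqFun.coeFn_smul c u.1

theorem enorm_ofFun (hf : AEStronglyMeasurable f m) (h : eLux Φ m f < ⊤) :
    ‖ofFun Φ m f‖ₑ = eLux Φ m f := by
  rw [enorm_eq_eLux, eLux_congr (coe_ofFun hf h)]

theorem ofFun_congr (h : f =ᵐ[m] g) : ofFun Φ m f = ofFun Φ m g := by
  by_cases hf : AEStronglyMeasurable f m ∧ eLux Φ m f < ⊤
  · exact eq_ofFun ((coe_ofFun hf.1 hf.2).trans h)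
  · have hg : ¬ (AEStronglyMeasurable g m ∧ eLux Φ m g < ⊤) := by
      rwa [← eLux_congr h, ← aestronglyMeasurable_congr h]
    rw [ofFun, ofFun, dif_neg hf, dif_neg hg]

theorem ofFun_coe (u : OrliczSpace Φ m) : ofFun Φ m (u : α →ₘ[m] ℂ) = u :=
  (eq_ofFun (ae_eq_refl _)).symm

theorem ofFun_zero : ofFun Φ m (0 : α → ℂ) = 0 := (eq_ofFun AEEqFun.coeFn_zero).symm

theorem ofFun_add (hf : AEStronglyMeasurable f m) (hf' : eLux Φ m f < ⊤)
    (hg : AEStronglyMeasurable g m) (hg' : eLux Φ m g < ⊤) :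
    ofFun Φ m (f + g) = ofFun Φ m f + ofFun Φ m g := by
  refine (eq_ofFun ((coe_add_ae _ _).trans ?_)).symm
  filter_upwards [coe_ofFun hf hf', coe_ofFun hg hg'] with x h1 h2
  rw [h1, h2, Pi.add_apply]

theorem ofFun_smul (c : ℂ) (hf : AEStronglyMeasurable f m) (hf' : eLux Φ m f < ⊤) :
    ofFun Φ m (c • f) = c • ofFun Φ m f := by
  refine (eq_ofFun ((coe_smul_ae _ _).trans ?_)).symm
  filter_upwards [coe_ofFun hf hf'] with x h1
  rw [h1, Pi.smul_apply, smul_eq_mul]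

theorem ofFun_sub (hf : AEStronglyMeasurable f m) (hf' : eLux Φ m f < ⊤)
    (hg : AEStronglyMeasurable g m) (hg' : eLux Φ m g < ⊤) :
    ofFun Φ m (f - g) = ofFun Φ m f - ofFun Φ m g := by
  refine (eq_ofFun ((coe_sub_ae _ _).trans ?_)).symm
  filter_upwards [coe_ofFun hf hf', coe_ofFun hg hg'] with x h1 h2
  rw [h1, h2, Pi.sub_apply]

theorem eLux_two_smul_le : eLux Φ m ((2 : ℂ) • f) ≤ 2 * eLux Φ m f := by
  refine le_of_forall_gt fun c hc => ?_
  have h2 : eLux Φ m f < c / 2 := by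
    rwa [ENNReal.lt_div_iff_mul_lt (by simp) (by simp), mul_comm]
  obtain ⟨k, hk, hkc⟩ := exists_mem_luxSet_of_eLux_lt h2
  refine (eLux_le (mem_luxSet_smul Φ two_ne_zero hk)).trans_lt ?_
  have : ‖(2 : ℂ)‖₊ = 2 := by simp
  rw [this, ENNReal.coe_mul, mul_comm]
  rwa [ENNReal.lt_div_iff_mul_lt (by simp) (by simp)] at hkc

theorem eLux_indicator_le (E : Set α) : eLux Φ m (E.indicator f) ≤ eLux Φ m f :=
  eLux_mono (ae_of_all _ fun _ => norm_indicator_le_norm_self _ _)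

end LuxemburgGauge

/-! ### Growth of Young functions at zero and at infinity. -/

section YoungGrowth

/-- Near infinity a Young function dominates a linear function. -/
theorem YoungFunction.exists_le_add_mul (Φ : YoungFunction) :
    ∃ C : ℝ≥0, 0 < C ∧ ∀ x : ℝ≥0, (x : ℝ≥0∞) ≤ C + C * Φ x := by
  obtain ⟨c, hc1, hc0⟩ := ((Φ.tendsto'.eventually (lt_mem_nhds ENNReal.one_lt_top)).and
    (eventually_gt_atTop 0)).exists
  refine ⟨c, hc0, fun x => ?_⟩
  rcases le_total x c with hx | hx
  · exact le_add_right (by exact_mod_cast hx)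
  · have hx0 : 0 < x := hc0.trans_le hx
    -- Convexity between `0` and `x`, read at `c`: since `1 < Φ c`, the slope of `Φ` beyond `c` is
    -- at least `1 / c`.
    have h := Φ.convex_le (a := c / x) (b := 1 - c / x) (x := x) (y := 0)
      (add_tsub_cancel_of_le (div_le_one_of_le₀ hx zero_le))
    rw [Φ.zero', mul_zero, mul_zero, add_zero, add_zero, div_mul_cancel₀ _ hx0.ne'] at h
    refine le_add_left ?_
    calc (x : ℝ≥0∞) = x * 1 := (mul_one _).symm
      _ ≤ x * (((c / x : ℝ≥0) : ℝ≥0∞) * Φ x) := by gcongr; exact hc1.le.trans h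
      _ = c * Φ x := by
        rw [← mul_assoc, ← ENNReal.coe_mul, mul_div_cancel₀ _ hx0.ne']

theorem YoungFunction.le_mul_one (Φ : YoungFunction) {x : ℝ≥0} (hx : x ≤ 1) :
    Φ x ≤ x * Φ 1 := by
  have h := Φ.convex_le (a := x) (b := 1 - x) (x := 1) (y := 0) (add_tsub_cancel_of_le hx)
  simpa [Φ.zero'] using h

variable {Φ : YoungFunction}

theorem YoungFunction.tendsto_nhds_zero (hfin : ∀ x : ℝ≥0, Φ x ≠ ⊤) :
    Tendsto Φ.toFun (𝓝 0) (𝓝 0) := by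
  have h : Tendsto (fun x : ℝ≥0 => (x : ℝ≥0∞) * Φ 1) (𝓝 0) (𝓝 0) := by
    have : Tendsto (fun x : ℝ≥0 => (x : ℝ≥0∞) * Φ 1) (𝓝 0) (𝓝 (((0 : ℝ≥0) : ℝ≥0∞) * Φ 1)) :=
      ENNReal.Tendsto.mul_const (ENNReal.continuous_coe.tendsto 0) (Or.inr (hfin 1))
    simpa using this
  refine tendsto_of_tendsto_of_tendsto_of_le_of_le' tendsto_const_nhds h
    (Eventually.of_forall fun _ => zero_le) ?_
  filter_upwards [Iic_mem_nhds (zero_lt_one (α := ℝ≥0))] with x hx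
  exact Φ.le_mul_one hx

theorem YoungFunction.exists_pos_le_one (hfin : ∀ x : ℝ≥0, Φ x ≠ ⊤) :
    ∃ x : ℝ≥0, 0 < x ∧ Φ x ≤ 1 := by
  have h := (YoungFunction.tendsto_nhds_zero hfin).eventually (ge_mem_nhds (zero_lt_one))
  have h' : ∀ᶠ x in 𝓝[>] (0 : ℝ≥0), Φ x ≤ 1 := nhdsWithin_le_nhds h
  obtain ⟨x, hx, hx0⟩ := (h'.and self_mem_nhdsWithin).exists
  exact ⟨x, hx0, hx⟩

/-- A finite Young function satisfying the `Δ₂`-condition obeys `Φ(2x) ≤ K Φ(x) + L` everywhere. -/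
theorem DeltaTwo.exists_le_add (hfin : ∀ x : ℝ≥0, Φ x ≠ ⊤) (hΦ : DeltaTwo Φ) :
    ∃ K L : ℝ≥0, ∀ x : ℝ≥0, Φ (2 * x) ≤ K * Φ x + L := by
  obtain ⟨K, x₀, -, -, h⟩ := hΦ
  refine ⟨K, (Φ (2 * x₀)).toNNReal, fun x => ?_⟩
  rw [ENNReal.coe_toNNReal (hfin _)]
  rcases le_total x₀ x with hx | hx
  · exact le_add_right (h x hx)
  · exact le_add_left (Φ.mono (by gcongr))

end YoungGrowth

/-! ### Embedding into `L¹`, and order continuity of the norm from the `Δ₂`-condition. -/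

section OrderContinuity

variable {α : Type*} [MeasurableSpace α] {Φ : YoungFunction} {m : Measure α} {f g : α → ℂ}

theorem aemeasurable_young (hf : AEStronglyMeasurable f m) (k : ℝ≥0) :
    AEMeasurable (fun x => Φ (‖f x‖₊ / k)) m :=
  Φ.mono.measurable.comp_aemeasurable (hf.aemeasurable.nnnorm.div_const k)

/-- The Orlicz space of a finite measure embeds continuously into `L¹`. -/
theorem exists_lintegral_le_mul_eLux (Φ : YoungFunction) (m : Measure α) [IsFiniteMeasure m] :
    ∃ C : ℝ≥0, ∀ f : α → ℂ, ∫⁻ x, ‖f x‖ₑ ∂m ≤ C * eLux Φ m f := by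
  obtain ⟨C, hC0, hC⟩ := Φ.exists_le_add_mul
  have key : ∀ f : α → ℂ, ∀ k ∈ luxSet Φ m f,
      ∫⁻ x, ‖f x‖ₑ ∂m ≤ ((C * (m Set.univ).toNNReal + C : ℝ≥0) : ℝ≥0∞) * k := by
    intro f k hk
    have hk0 : k ≠ 0 := hk.1.ne'
    calc ∫⁻ x, ‖f x‖ₑ ∂m ≤ ∫⁻ x, (k : ℝ≥0∞) * (C + C * Φ (‖f x‖₊ / k)) ∂m := by
          refine lintegral_mono fun x => ?_
          calc ‖f x‖ₑ = (k : ℝ≥0∞) * ((‖f x‖₊ / k : ℝ≥0) : ℝ≥0∞) := by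
                rw [← ENNReal.coe_mul, mul_div_cancel₀ _ hk0]; rfl
            _ ≤ _ := by gcongr; exact hC _
      _ = k * (C * m Set.univ + C * ∫⁻ x, Φ (‖f x‖₊ / k) ∂m) := by
          rw [lintegral_const_mul' _ _ ENNReal.coe_ne_top, lintegral_add_left measurable_const,
            lintegral_const, lintegral_const_mul' _ _ ENNReal.coe_ne_top]
      _ ≤ k * (C * m Set.univ + C * 1) := by gcongr; exact hk.2
      _ = _ := by
          push_cast
          rw [ENNReal.coe_toNNReal (measure_ne_top _ _)]
          ring
  refine ⟨C * (m Set.univ).toNNReal + C, fun f => ?_⟩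
  have hC' : ((C * (m Set.univ).toNNReal + C : ℝ≥0) : ℝ≥0∞) ≠ 0 := by
    exact_mod_cast (lt_add_of_nonneg_of_lt zero_le hC0).ne'
  rw [mul_comm, ← ENNReal.div_le_iff hC' ENNReal.coe_ne_top]
  refine le_iInf₂ fun k hk => ?_
  rw [ENNReal.div_le_iff hC' ENNReal.coe_ne_top, mul_comm]
  exact key f k hk

theorem integrable_of_eLux_lt_top [IsFiniteMeasure m] (hf : AEStronglyMeasurable f m) (h : eLux Φ m f < ⊤) :
    Integrable f m := by
  obtain ⟨C, hC⟩ := exists_lintegral_le_mul_eLux Φ m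
  exact ⟨hf, (hC f).trans_lt (ENNReal.mul_lt_top ENNReal.coe_lt_top h)⟩

theorem eLux_le_of_norm_le (hfin : ∀ x : ℝ≥0, Φ x ≠ ⊤) [IsProbabilityMeasure m] {ε : ℝ≥0}
    (hε : 0 < ε) : ∃ η : ℝ≥0, 0 < η ∧ ∀ f : α → ℂ, (∀ᵐ x ∂m, ‖f x‖₊ ≤ η) → eLux Φ m f ≤ ε := by
  obtain ⟨x, hx0, hx1⟩ := YoungFunction.exists_pos_le_one hfin
  refine ⟨ε * x, mul_pos hε hx0, fun f hf => eLux_le ⟨hε, ?_⟩⟩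
  calc ∫⁻ t, Φ (‖f t‖₊ / ε) ∂m ≤ ∫⁻ _, 1 ∂m := by
        refine lintegral_mono_ae ?_
        filter_upwards [hf] with t ht
        refine (Φ.mono ?_).trans hx1
        rwa [div_le_iff₀ hε, mul_comm]
    _ = 1 := by simp

theorem eLux_lt_top_of_norm_le (hfin : ∀ x : ℝ≥0, Φ x ≠ ⊤) [IsProbabilityMeasure m] {c : ℝ≥0}
    (hf : ∀ᵐ x ∂m, ‖f x‖₊ ≤ c) : eLux Φ m f < ⊤ := by
  obtain ⟨x, hx0, hx1⟩ := YoungFunction.exists_pos_le_one hfin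
  have hk : 0 < (c + 1) / x := by positivity
  refine eLux_lt_top_iff.2 ⟨(c + 1) / x, hk, ?_⟩
  calc ∫⁻ t, Φ (‖f t‖₊ / ((c + 1) / x)) ∂m ≤ ∫⁻ _, 1 ∂m := by
        refine lintegral_mono_ae ?_
        filter_upwards [hf] with t ht
        refine (Φ.mono ?_).trans hx1
        rw [div_le_iff₀ hk, mul_div_cancel₀ _ hx0.ne']
        exact ht.trans le_self_add
    _ = 1 := by simp

/-- The modular is finite at one scale `k`; each doubling of the argument costs a factor `K` and a
constant `L`, which a finite measure absorbs. Finitely many doublings reach the scale `ε`. -/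
theorem lintegral_young_lt_top (hfin : ∀ x : ℝ≥0, Φ x ≠ ⊤) (hΦ : DeltaTwo Φ) [IsFiniteMeasure m]
    (hf : eLux Φ m f < ⊤) {ε : ℝ≥0} (hε : 0 < ε) : ∫⁻ x, Φ (‖f x‖₊ / ε) ∂m < ⊤ := by
  obtain ⟨k, hk0, hk⟩ := eLux_lt_top_iff.1 hf
  obtain ⟨K, L, hKL⟩ := DeltaTwo.exists_le_add hfin hΦ
  have hpow : ∀ n : ℕ, ∫⁻ x, Φ (2 ^ n * (‖f x‖₊ / k)) ∂m < ⊤ := by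
    intro n
    induction n with
    | zero => simpa using hk.trans_lt ENNReal.one_lt_top
    | succ n ih =>
      calc ∫⁻ x, Φ (2 ^ (n + 1) * (‖f x‖₊ / k)) ∂m
          ≤ ∫⁻ x, (K * Φ (2 ^ n * (‖f x‖₊ / k)) + L) ∂m := by
            refine lintegral_mono fun x => ?_
            rw [pow_succ', mul_assoc]
            exact hKL _
        _ = K * ∫⁻ x, Φ (2 ^ n * (‖f x‖₊ / k)) ∂m + L * m Set.univ := by
            rw [lintegral_add_right _ measurable_const, lintegral_const,
              lintegral_const_mul' _ _ ENNReal.coe_ne_top]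
        _ < ⊤ := ENNReal.add_lt_top.2 ⟨ENNReal.mul_lt_top ENNReal.coe_lt_top ih,
            ENNReal.mul_lt_top ENNReal.coe_lt_top (measure_lt_top _ _)⟩
  obtain ⟨n, hn⟩ := pow_unbounded_of_one_lt (k / ε) (one_lt_two (α := ℝ≥0))
  refine (lintegral_mono fun x => Φ.mono ?_).trans_lt (hpow n)
  calc ‖f x‖₊ / ε = k / ε * (‖f x‖₊ / k) := by
        have := hk0.ne'
        have := hε.ne'
        field_simp
    _ ≤ 2 ^ n * (‖f x‖₊ / k) := by gcongr

/-- Dominated convergence in the Luxemburg gauge. -/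
theorem tendsto_eLux_of_dominated (hfin : ∀ x : ℝ≥0, Φ x ≠ ⊤) (hΦ : DeltaTwo Φ)
    [IsFiniteMeasure m] (hg : eLux Φ m g < ⊤) {F : ℕ → α → ℂ}
    (hF : ∀ n, AEStronglyMeasurable (F n) m) (hle : ∀ n, ∀ᵐ x ∂m, ‖F n x‖ ≤ ‖g x‖)
    (hlim : ∀ᵐ x ∂m, Tendsto (fun n => F n x) atTop (𝓝 0)) :
    Tendsto (fun n => eLux Φ m (F n)) atTop (𝓝 0) := by
  refine ENNReal.tendsto_nhds_zero.2 fun ε hε => ?_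
  obtain ⟨δ, hδ0, hδε⟩ := ENNReal.lt_iff_exists_nnreal_btwn.1 hε
  have hδ : 0 < δ := by exact_mod_cast hδ0
  have hT : Tendsto (fun n => ∫⁻ x, Φ (‖F n x‖₊ / δ) ∂m) atTop (𝓝 (∫⁻ _, 0 ∂m)) := by
    -- The majorant must be integrable for this arbitrarily small `δ`, which is what the
    -- `Δ₂`-condition provides.
    refine tendsto_lintegral_of_dominated_convergence' (fun x => Φ (‖g x‖₊ / δ))
      (fun n => aemeasurable_young (hF n) δ) (fun n => ?_)
      (lintegral_young_lt_top hfin hΦ hg hδ).ne ?_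
    · filter_upwards [hle n] with x hx
      refine Φ.mono ?_
      have : ‖F n x‖₊ ≤ ‖g x‖₊ := hx
      gcongr
    · filter_upwards [hlim] with x hx
      refine (YoungFunction.tendsto_nhds_zero hfin).comp ?_
      have : Tendsto (fun n => ‖F n x‖₊ / δ) atTop (𝓝 (‖(0 : ℂ)‖₊ / δ)) := hx.nnnorm.div_const δ
      simpa using this
  rw [lintegral_zero] at hT
  filter_upwards [hT.eventually (ge_mem_nhds zero_lt_one)] with n hn
  exact (eLux_le ⟨hδ, hn⟩).trans hδε.le

/-- The Luxemburg gauge of a function is absolutely continuous. -/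
theorem exists_eLux_indicator_le (hfin : ∀ x : ℝ≥0, Φ x ≠ ⊤) (hΦ : DeltaTwo Φ)
    [IsFiniteMeasure m] (hf : eLux Φ m f < ⊤) {ε : ℝ≥0} (hε : 0 < ε) :
    ∃ δ : ℝ≥0∞, 0 < δ ∧ ∀ E, NullMeasurableSet E m → m E < δ → eLux Φ m (E.indicator f) ≤ ε := by
  obtain ⟨δ, hδ, h⟩ := exists_pos_setLIntegral_lt_of_measure_lt
    (lintegral_young_lt_top hfin hΦ hf hε).ne one_ne_zero
  refine ⟨δ, hδ, fun E hE hmE => eLux_le ⟨hε, ?_⟩⟩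
  have : ∀ x, Φ (‖E.indicator f x‖₊ / ε) = E.indicator (fun x => Φ (‖f x‖₊ / ε)) x := by
    intro x
    by_cases hx : x ∈ E <;> simp [hx, Φ.zero']
  simp_rw [this, lintegral_indicator₀ hE]
  exact (h E hmE).le

end OrderContinuity

/-! ### Variation of complex measures and integration against them. -/

section ComplexMeasure

variable {α : Type*} [MeasurableSpace α]

theorem norm_mul_bilin (x y : ℂ) : ‖ContinuousLinearMap.mul ℝ ℂ x y‖₊ = ‖x‖₊ * ‖y‖₊ := by
  simp

/-- The total variation of a complex measure is at most four times the supremum of its values. -/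
theorem variation_le_four_mul (κ : ComplexMeasure α) {S : Set α} (hS : MeasurableSet S)
    {c : ℝ≥0∞} (h : ∀ A ⊆ S, MeasurableSet A → ‖κ A‖ₑ ≤ c) : κ.variation S ≤ 4 * c := by
  have hre : ∀ A, (ComplexMeasure.re κ) A = (κ A).re := fun A => rfl
  have him : ∀ A, (ComplexMeasure.im κ) A = (κ A).im := fun A => rfl
  have hle : κ.variation ≤ (ComplexMeasure.re κ).variation + (ComplexMeasure.im κ).variation := by
    refine VectorMeasure.variation_le_of_forall_enorm_le fun E _ => ?_
    rw [Measure.add_apply]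
    refine le_trans ?_ (add_le_add (VectorMeasure.enorm_measure_le_variation _ E)
      (VectorMeasure.enorm_measure_le_variation _ E))
    rw [hre, him, ← ofReal_norm, ← ofReal_norm, ← ofReal_norm,
      ← ENNReal.ofReal_add (norm_nonneg _) (norm_nonneg _)]
    exact ENNReal.ofReal_le_ofReal (Complex.norm_le_abs_re_add_abs_im _)
  -- A signed measure has a subset carrying more than half of any amount below its variation; real
  -- and imaginary parts together give the factor `4`.
  have two : ∀ σ : SignedMeasure α, (∀ A ⊆ S, MeasurableSet A → ‖σ A‖ₑ ≤ c) →
      σ.variation S ≤ 2 * c := by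
    intro σ hσ
    by_contra hlt
    obtain ⟨t, hts, ht, hlt'⟩ := σ.exists_subset_lt_enorm_apply_of_lt_variation hS (not_le.1 hlt)
    exact absurd (mul_le_mul_right (hσ t hts ht) 2) (not_le.2 hlt')
  calc κ.variation S ≤ _ := hle S
    _ ≤ 2 * c + 2 * c := by
      rw [Measure.add_apply]
      refine add_le_add (two _ fun A hA hm => le_trans ?_ (h A hA hm))
        (two _ fun A hA hm => le_trans ?_ (h A hA hm))
      · rw [hre, ← ofReal_norm, ← ofReal_norm]
        exact ENNReal.ofReal_le_ofReal (Complex.abs_re_le_norm _)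
      · rw [him, ← ofReal_norm, ← ofReal_norm]
        exact ENNReal.ofReal_le_ofReal (Complex.abs_im_le_norm _)
    _ = 4 * c := by ring

theorem isFiniteMeasure_variation (κ : ComplexMeasure α) : IsFiniteMeasure κ.variation :=
  ⟨(variation_le_four_mul κ MeasurableSet.univ
    (fun A _ _ => VectorMeasure.enorm_apply_le_bound)).trans_lt
    (ENNReal.mul_lt_top (by simp) ENNReal.coe_lt_top)⟩

variable {ρ : ComplexMeasure α} {f g : α → ℂ}

theorem enorm_cintegral_le (ρ : ComplexMeasure α) (f : α → ℂ) :
    ‖cintegral ρ f‖ₑ ≤ ∫⁻ x, ‖f x‖ₑ ∂ρ.variation := by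
  refine (VectorMeasure.enorm_integral_le_lintegral_enorm_transpose).trans_eq ?_
  rw [VectorMeasure.variation_transpose_eq _ _ norm_mul_bilin]

theorem norm_cintegral_le (ρ : ComplexMeasure α) (f : α → ℂ) :
    ‖cintegral ρ f‖ ≤ ∫ x, ‖f x‖ ∂ρ.variation := by
  refine (VectorMeasure.norm_integral_le_integral_norm).trans ?_
  simp

theorem cintegral_congr (h : f =ᵐ[ρ.variation] g) : cintegral ρ f = cintegral ρ g :=
  VectorMeasure.integral_congr_ae h

theorem cintegral_add (hf : Integrable f ρ.variation) (hg : Integrable g ρ.variation) :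
    cintegral ρ (fun x => f x + g x) = cintegral ρ f + cintegral ρ g :=
  VectorMeasure.integral_fun_add hf hg

theorem cintegral_sub (hf : Integrable f ρ.variation) (hg : Integrable g ρ.variation) :
    cintegral ρ (fun x => f x - g x) = cintegral ρ f - cintegral ρ g :=
  VectorMeasure.integral_fun_sub hf hg

theorem cintegral_const_mul (c : ℂ) (f : α → ℂ) :
    cintegral ρ (fun x => c * f x) = c * cintegral ρ f := by
  -- The integral is built from a real bilinear map; complex scalars still come out because the
  -- product with `ρ A` is complex linear.
  refine (setToFun_smul (𝕜 := ℂ) (dominatedFinMeasAdditive_cbmApplyMeasure ρ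
    (ContinuousLinearMap.mul ℝ ℂ)) (fun c A x => ?_) c f)
  exact mul_assoc c x (ρ A)

theorem cintegral_indicator {A : Set α} (hA : MeasurableSet A) (f : α → ℂ) :
    cintegral ρ (A.indicator f) = cintegral (ρ.restrict A) f :=
  VectorMeasure.integral_indicator hA

/-- The integral of `|f|` against the variation is controlled by the integrals of `f` over sets. -/
theorem lintegral_variation_le (hf : Integrable f ρ.variation) {S : Set α} (hS : MeasurableSet S)
    {c : ℝ≥0∞} (h : ∀ A ⊆ S, MeasurableSet A → ‖cintegral (ρ.restrict A) f‖ₑ ≤ c) :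
    ∫⁻ x in S, ‖f x‖ₑ ∂ρ.variation ≤ 4 * c := by
  -- The measure `|f| d|ρ|` is the variation of the complex measure `A ↦ ∫_A f dρ`, to which the
  -- bound by set values applies.
  have h1 := VectorMeasure.variation_withDensity hf norm_mul_bilin
  rw [VectorMeasure.variation_transpose_eq _ _ norm_mul_bilin] at h1
  rw [← withDensity_apply _ hS, ← h1]
  refine variation_le_four_mul _ hS fun A hA hAm => ?_
  rw [VectorMeasure.withDensity_apply hf]
  exact h A hA hAm

end ComplexMeasure

/-! ### The space `L¹(ν)` of a general vector measure. -/

section Integration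

variable {α : Type*} [MeasurableSpace α] {X : Type*} [NormedAddCommGroup X] [NormedSpace ℂ X]
  {ν : VectorMeasure α X} {f g : α → ℂ}

theorem pairing_apply (ν : VectorMeasure α X) (x' : StrongDual ℂ X) (A : Set α) :
    pairing ν x' A = x' (ν A) := rfl

instance (ν : VectorMeasure α X) (x' : StrongDual ℂ X) :
    IsFiniteMeasure (pairing ν x').variation := isFiniteMeasure_variation _

theorem HasVectorIntegral.unique {A : Set α} {x y : X} (hx : HasVectorIntegral ν f A x)
    (hy : HasVectorIntegral ν f A y) : x = y :=
  (SeparatingDual.eq_iff_forall_dual_eq (R := ℂ)).2 fun x' => (hx x').symm.trans (hy x')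

/-- The dual separates points by Hahn–Banach, so the uniqueness clause is automatic. -/
theorem memL1_of_forall_exists (hf : WeaklyIntegrable ν f)
    (h : ∀ A, MeasurableSet A → ∃ x, HasVectorIntegral ν f A x) : MemL1 ν f :=
  ⟨hf, fun A hA => let ⟨x, hx⟩ := h A hA; ⟨x, hx, fun _ hy => hy.unique hx⟩⟩

theorem hasVectorIntegral_integrationOp (hf : MemL1 ν f) :
    HasVectorIntegral ν f Set.univ (integrationOp ν f) := by
  rw [integrationOp, dif_pos hf]
  exact (hf.2 Set.univ MeasurableSet.univ).choose_spec.1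

theorem integrationOp_eq (hf : MemL1 ν f) {x : X} (hx : HasVectorIntegral ν f Set.univ x) :
    integrationOp ν f = x := (hasVectorIntegral_integrationOp hf).unique hx

theorem HasVectorIntegral.indicator {A B : Set α} {x : X} (hA : MeasurableSet A)
    (hB : MeasurableSet B) (hx : HasVectorIntegral ν f (A ∩ B) x) :
    HasVectorIntegral ν (B.indicator f) A x := fun x' => by
  rw [← hx x', cintegral_indicator hB, VectorMeasure.restrict_restrict _ hB hA, Set.inter_comm]

theorem MemL1.indicator (hf : MemL1 ν f) {B : Set α} (hB : MeasurableSet B) :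
    MemL1 ν (B.indicator f) :=
  memL1_of_forall_exists (fun x' => (hf.1 x').indicator hB) fun A hA =>
    let ⟨x, hx, _⟩ := hf.2 (A ∩ B) (hA.inter hB)
    ⟨x, hx.indicator hA hB⟩

/-- A norming functional for the integral, from Hahn–Banach, reduces the bound to the scalar
measures. -/
theorem enorm_integrationOp_le (hf : MemL1 ν f) : ‖integrationOp ν f‖ₑ ≤ vnorm ν f := by
  obtain ⟨x', hx', h⟩ := exists_dual_vector'' ℂ (integrationOp ν f)
  have h1 := hasVectorIntegral_integrationOp hf x'
  rw [VectorMeasure.restrict_univ] at h1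
  calc ‖integrationOp ν f‖ₑ = ‖x' (integrationOp ν f)‖ₑ := by
        rw [h, ← ofReal_norm, ← ofReal_norm]; simp
    _ = ‖cintegral (pairing ν x') f‖ₑ := by rw [h1]
    _ ≤ ∫⁻ t, ‖f t‖ₑ ∂(pairing ν x').variation := enorm_cintegral_le _ _
    _ ≤ vnorm ν f := le_iSup₂ (f := fun (x' : StrongDual ℂ X) (_ : ‖x'‖ ≤ 1) =>
        ∫⁻ t, ‖f t‖ₑ ∂(pairing ν x').variation) x' hx'

/-- The norm of `L¹(ν)` is controlled by the norms of the integrals over sets. -/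
theorem vnorm_le_of_forall (hf : MemL1 ν f) {c : ℝ≥0∞}
    (h : ∀ A, MeasurableSet A → ‖integrationOp ν (A.indicator f)‖ₑ ≤ c) :
    vnorm ν f ≤ 4 * c := by
  refine iSup₂_le fun x' hx' => ?_
  rw [← setLIntegral_univ]
  refine lintegral_variation_le (hf.1 x') MeasurableSet.univ fun A _ hA => ?_
  have h1 := hasVectorIntegral_integrationOp (hf.indicator hA) x'
  rw [VectorMeasure.restrict_univ, cintegral_indicator hA] at h1
  rw [h1]
  refine le_trans ?_ (h A hA)
  refine (x'.le_opENorm _).trans (mul_le_of_le_one_left zero_le ?_)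
  rw [← ofReal_norm]
  exact ENNReal.ofReal_le_one.2 hx'

/-- The norm of `L¹(ν)` is finite, by the uniform boundedness principle. -/
theorem vnorm_lt_top (hf : MemL1 ν f) : vnorm ν f < ⊤ := by
  -- The integrals over all measurable sets are viewed in the bidual: uniform boundedness is applied
  -- on the dual, which is complete even when `X` is not. At `x'` they are bounded by `∫ |f| d|⟨ν,
  -- x'⟩|`.
  let e : {A : Set α // MeasurableSet A} → (StrongDual ℂ (StrongDual ℂ X)) := fun A =>
    NormedSpace.inclusionInDoubleDual ℂ X (integrationOp ν (A.1.indicator f))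
  obtain ⟨C, hC⟩ := banach_steinhaus (g := e) (fun x' => by
    refine ⟨∫ t, ‖f t‖ ∂(pairing ν x').variation, fun A => ?_⟩
    have h1 := hasVectorIntegral_integrationOp (hf.indicator A.2) x'
    rw [VectorMeasure.restrict_univ] at h1
    change ‖x' (integrationOp ν (A.1.indicator f))‖ ≤ _
    rw [← h1]
    refine (norm_cintegral_le _ _).trans (integral_mono ((hf.1 x').indicator A.2).norm
      (hf.1 x').norm fun t => norm_indicator_le_norm_self _ _))
  refine (vnorm_le_of_forall hf (c := ENNReal.ofReal C) fun A hA => ?_).trans_lt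
    (ENNReal.mul_lt_top (by simp) ENNReal.ofReal_lt_top)
  rw [← ofReal_norm]
  refine ENNReal.ofReal_le_ofReal ?_
  have := hC ⟨A, hA⟩
  rwa [show ‖e ⟨A, hA⟩‖ = ‖integrationOp ν (A.indicator f)‖ from
    (NormedSpace.inclusionInDoubleDualLi ℂ (E := X)).norm_map _] at this

end Integration

/-! ### The vector measure of a bounded operator on an Orlicz space. -/

section OperatorMeasure

variable {α : Type*} [MeasurableSpace α] {X : Type*} [NormedAddCommGroup X] [NormedSpace ℂ X]
  {Φ : YoungFunction} {m : Measure α}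

theorem aestronglyMeasurable_indicator_one {A : Set α} (hA : MeasurableSet A) :
    AEStronglyMeasurable (A.indicator (1 : α → ℂ)) m :=
  aestronglyMeasurable_one.indicator hA

theorem eLux_indicator_one_lt_top [IsProbabilityMeasure m] (hfin : ∀ x : ℝ≥0, Φ x ≠ ⊤) (A : Set α) :
    eLux Φ m (A.indicator (1 : α → ℂ)) < ⊤ :=
  eLux_lt_top_of_norm_le (c := 1) hfin (ae_of_all _ fun x => by
    by_cases hx : x ∈ A <;> simp [hx])

omit [MeasurableSpace α] in
theorem sum_indicator_one {ι : Type*} {A : ι → Set α} (hd : Pairwise (Function.onFun Disjoint A))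
    (s : Finset ι) :
    ∑ i ∈ s, (A i).indicator (1 : α → ℂ) = (⋃ i ∈ s, A i).indicator (1 : α → ℂ) := by
  classical
  induction s using Finset.induction_on with
  | empty => simp only [Finset.sum_empty, Finset.notMem_empty, Set.iUnion_of_empty,
      Set.iUnion_empty, Set.indicator_empty']
  | insert i s hi ih =>
    rw [Finset.sum_insert hi, ih, Finset.set_biUnion_insert, Set.indicator_union_of_disjoint]
    · rfl
    · exact Set.disjoint_iUnion₂_right.2 fun j hj => hd (by rintro rfl; exact hi hj)

theorem ofFun_finset_sum {ι : Type*} (s : Finset ι) {F : ι → α → ℂ}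
    (hF : ∀ i, AEStronglyMeasurable (F i) m) (hF' : ∀ i, eLux Φ m (F i) < ⊤) :
    AEStronglyMeasurable (∑ i ∈ s, F i) m ∧ eLux Φ m (∑ i ∈ s, F i) < ⊤ ∧
      ofFun Φ m (∑ i ∈ s, F i) = ∑ i ∈ s, ofFun Φ m (F i) := by
  classical
  induction s using Finset.induction_on with
  | empty =>
    refine ⟨aestronglyMeasurable_zero, ?_, ?_⟩
    · rw [Finset.sum_empty, eLux_zero]; exact ENNReal.zero_lt_top
    · rw [Finset.sum_empty, Finset.sum_empty, ofFun_zero]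
  | insert i s hi ih =>
    rw [Finset.sum_insert hi, Finset.sum_insert hi]
    refine ⟨(hF i).add ih.1, (eLux_add_le (hF i)).trans_lt
      (ENNReal.add_lt_top.2 ⟨hF' i, ih.2.1⟩), ?_⟩
    rw [ofFun_add (hF i) (hF' i) ih.1 ih.2.1, ih.2.2]

variable [IsProbabilityMeasure m]

/-- Indicator functions are countably additive in the Orlicz space. -/
theorem hasSum_ofFun_indicator (hfin : ∀ x : ℝ≥0, Φ x ≠ ⊤) (hΦ : DeltaTwo Φ) {A : ℕ → Set α}
    (hA : ∀ i, MeasurableSet (A i)) (hd : Pairwise (Function.onFun Disjoint A)) :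
    HasSum (fun i => ofFun Φ m ((A i).indicator 1)) (ofFun Φ m ((⋃ i, A i).indicator 1)) := by
  have hU : MeasurableSet (⋃ i, A i) := MeasurableSet.iUnion hA
  have h1 : eLux Φ m (1 : α → ℂ) < ⊤ := by
    simpa using eLux_indicator_one_lt_top (Φ := Φ) (m := m) hfin Set.univ
  have key : ∀ s : Finset ℕ, ofFun Φ m ((⋃ i, A i).indicator 1)
      - ∑ i ∈ s, ofFun Φ m ((A i).indicator 1)
      = ofFun Φ m (((⋃ i, A i) \ ⋃ i ∈ s, A i).indicator 1) := by
    intro s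
    have hs : MeasurableSet (⋃ i ∈ s, A i) := s.measurableSet_biUnion fun i _ => hA i
    rw [← (ofFun_finset_sum s (fun i => aestronglyMeasurable_indicator_one (hA i))
        (fun i => eLux_indicator_one_lt_top hfin (A i))).2.2, sum_indicator_one hd,
      ← ofFun_sub (aestronglyMeasurable_indicator_one hU) (eLux_indicator_one_lt_top hfin _)
        (aestronglyMeasurable_indicator_one hs) (eLux_indicator_one_lt_top hfin _),
      Set.indicator_sdiff (Set.iUnion₂_subset fun i _ => Set.subset_iUnion A i)]
  -- Summation is unconditional, so the remainder is measured by the tail of `∑ m (A i)` over the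
  -- complement of a finite set.
  have hmeas : Tendsto (fun s : Finset ℕ => m ((⋃ i, A i) \ ⋃ i ∈ s, A i)) atTop (𝓝 0) := by
    have hsum : ∑' i, m (A i) ≠ ⊤ := by
      rw [← measure_iUnion hd hA]
      exact measure_ne_top _ _
    refine tendsto_of_tendsto_of_tendsto_of_le_of_le tendsto_const_nhds
      (ENNReal.tendsto_tsum_compl_atTop_zero hsum) (fun _ => zero_le) fun s => ?_
    refine (measure_mono ?_).trans (measure_iUnion_le fun i : {x // x ∉ s} => A i)
    rintro x ⟨hx, hxs⟩
    obtain ⟨i, hi⟩ := Set.mem_iUnion.1 hx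
    exact Set.mem_iUnion.2 ⟨⟨i, fun his => hxs (Set.mem_iUnion₂.2 ⟨i, his, hi⟩)⟩, hi⟩
  rw [HasSum, SummationFilter.unconditional_filter, tendsto_iff_norm_sub_tendsto_zero]
  simp_rw [norm_sub_rev, key]
  rw [← tendsto_zero_iff_norm_tendsto_zero, tendsto_zero_iff_enorm_tendsto_zero]
  refine ENNReal.tendsto_nhds_zero.2 fun ε hε => ?_
  obtain ⟨η, hη0, hηε⟩ := ENNReal.lt_iff_exists_nnreal_btwn.1 hε
  obtain ⟨δ, hδ, hE⟩ := exists_eLux_indicator_le hfin hΦ h1 (ε := η) (by exact_mod_cast hη0)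
  filter_upwards [hmeas.eventually (gt_mem_nhds hδ)] with s hs
  have hm : MeasurableSet ((⋃ i, A i) \ ⋃ i ∈ s, A i) :=
    hU.diff (s.measurableSet_biUnion fun i _ => hA i)
  rw [enorm_ofFun (aestronglyMeasurable_indicator_one hm) (eLux_indicator_one_lt_top hfin _)]
  exact (hE _ hm.nullMeasurableSet hs).trans hηε.le

open Classical in
/-- The vector measure `A ↦ T(χ_A)` of an operator `T` on an Orlicz space. -/
def operatorMeasure (hfin : ∀ x : ℝ≥0, Φ x ≠ ⊤) (hΦ : DeltaTwo Φ)
    (T : OrliczSpace Φ m →L[ℂ] X) : VectorMeasure α X where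
  measureOf' A := if MeasurableSet A then T (ofFun Φ m (A.indicator 1)) else 0
  empty' := by simp only [MeasurableSet.empty, if_true, Set.indicator_empty', ofFun_zero, map_zero]
  not_measurable' A hA := if_neg hA
  m_iUnion' A hA hd := by
    simp only [hA, MeasurableSet.iUnion hA, if_true]
    exact T.hasSum (hasSum_ofFun_indicator hfin hΦ hA hd)

variable {hfin : ∀ x : ℝ≥0, Φ x ≠ ⊤} {hΦ : DeltaTwo Φ} {T : OrliczSpace Φ m →L[ℂ] X}

theorem operatorMeasure_apply {A : Set α} (hA : MeasurableSet A) :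
    operatorMeasure hfin hΦ T A = T (ofFun Φ m (A.indicator 1)) := if_pos hA

theorem operatorMeasure_null {A : Set α} (hA : m A = 0) : operatorMeasure hfin hΦ T A = 0 := by
  by_cases hm : MeasurableSet A
  · have : A.indicator (1 : α → ℂ) =ᵐ[m] 0 := indicator_meas_zero hA
    rw [operatorMeasure_apply hm, ofFun_congr this, ofFun_zero, map_zero]
  · exact VectorMeasure.not_measurable _ hm

/-- Changing a function on an `m`-null set is thus invisible to every scalar measure, so classes
modulo `m` may be used for `ν`. -/
theorem pairing_operatorMeasure_absolutelyContinuous (x' : StrongDual ℂ X) :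
    (pairing (operatorMeasure hfin hΦ T) x').variation ≪ m := by
  refine Measure.AbsolutelyContinuous.mk fun A hA h0 => ?_
  rw [VectorMeasure.variation_apply_eq_zero hA]
  intro B hB _
  rw [pairing_apply, operatorMeasure_null (measure_mono_null hB h0), map_zero]

theorem cintegral_pairing_simpleFunc (x' : StrongDual ℂ X) (g : SimpleFunc α ℂ) :
    eLux Φ m g < ⊤ ∧
      cintegral (pairing (operatorMeasure hfin hΦ T) x') g = x' (T (ofFun Φ m g)) := by
  induction g using SimpleFunc.induction with
  | @const c A hA =>
    have hc : ⇑(SimpleFunc.piecewise A hA (SimpleFunc.const α c) (SimpleFunc.const α 0))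
        = c • A.indicator (1 : α → ℂ) := by
      ext x
      by_cases hx : x ∈ A <;> simp [hx]
    refine ⟨eLux_lt_top_of_norm_le (c := ‖c‖₊) hfin (ae_of_all _ fun x => ?_), ?_⟩
    · rw [hc]
      by_cases hx : x ∈ A <;> simp [hx]
    · have h1 : cintegral (pairing (operatorMeasure hfin hΦ T) x') (A.indicator 1)
          = x' (operatorMeasure hfin hΦ T A) := by
        rw [cintegral_indicator hA]
        have := VectorMeasure.integral_const
          (μ := (pairing (operatorMeasure hfin hΦ T) x').restrict A)
          (B := ContinuousLinearMap.mul ℝ ℂ) (1 : ℂ)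
        refine this.trans ?_
        rw [VectorMeasure.restrict_apply _ hA MeasurableSet.univ, Set.univ_inter, pairing_apply]
        simp
      rw [hc, ofFun_smul c (aestronglyMeasurable_indicator_one hA)
        (eLux_indicator_one_lt_top hfin _), map_smul, map_smul, smul_eq_mul,
        ← operatorMeasure_apply hA (hfin := hfin) (hΦ := hΦ), ← h1]
      exact cintegral_const_mul c _
  | add _ hf hg =>
    rename_i f g _
    have hfm := f.stronglyMeasurable.aestronglyMeasurable (μ := m)
    have hgm := g.stronglyMeasurable.aestronglyMeasurable (μ := m)
    rw [SimpleFunc.coe_add]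
    refine ⟨(eLux_add_le hfm).trans_lt (ENNReal.add_lt_top.2 ⟨hf.1, hg.1⟩), ?_⟩
    rw [ofFun_add hfm hf.1 hgm hg.1, map_add, map_add, ← hf.2, ← hg.2]
    exact cintegral_add (f.integrable_of_isFiniteMeasure) (g.integrable_of_isFiniteMeasure)

/-- Functions of the Orlicz space are integrable with respect to the vector measure of an operator
on the space, and the integral over a set is given by the operator. -/
theorem integrable_and_cintegral_pairing (x' : StrongDual ℂ X) {f : α → ℂ}
    (hf : StronglyMeasurable f) (hf' : eLux Φ m f < ⊤) :
    Integrable f (pairing (operatorMeasure hfin hΦ T) x').variation ∧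
      ∀ A, MeasurableSet A → cintegral ((pairing (operatorMeasure hfin hΦ T) x').restrict A) f
        = x' (T (ofFun Φ m (A.indicator f))) := by
  set ρ := pairing (operatorMeasure hfin hΦ T) x' with hρ
  let F : ℕ → SimpleFunc α ℂ := fun n =>
    SimpleFunc.approxOn f hf.measurable Set.univ 0 (Set.mem_univ 0) n
  have hFle : ∀ n x, ‖F n x‖ ≤ ‖((2 : ℂ) • f) x‖ := fun n x => by
    have := SimpleFunc.norm_approxOn_zero_le hf.measurable (s := Set.univ) (Set.mem_univ 0) x n
    rwa [Pi.smul_apply, norm_smul, Complex.norm_ofNat, two_mul]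
  have hFlim : ∀ x, Tendsto (fun n => F n x) atTop (𝓝 (f x)) := fun x =>
    SimpleFunc.tendsto_approxOn hf.measurable (Set.mem_univ 0) (by simp)
  have hFm : ∀ n, AEStronglyMeasurable (F n) m := fun n =>
    (F n).stronglyMeasurable.aestronglyMeasurable
  have h2f : eLux Φ m ((2 : ℂ) • f) < ⊤ :=
    eLux_two_smul_le.trans_lt (ENNReal.mul_lt_top (by simp) hf')
  have hind : ∀ n (A : Set α), MeasurableSet A → eLux Φ m (A.indicator (F n)) < ⊤ ∧
      cintegral ρ (A.indicator (F n)) = x' (T (ofFun Φ m (A.indicator (F n)))) := by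
    intro n A hA
    have := cintegral_pairing_simpleFunc (hfin := hfin) (hΦ := hΦ) (T := T) x'
      ((F n).restrict A)
    rwa [SimpleFunc.coe_restrict _ hA] at this
  have hint : Integrable f ρ.variation := by
    refine ⟨hf.aestronglyMeasurable, ?_⟩
    set c : ℝ≥0∞ := ‖x'‖ₑ * (‖T‖ₑ * eLux Φ m ((2 : ℂ) • f)) with hc
    -- The integrals of `F n` over sets are values of `x' ∘ T` on functions dominated by `2 |f|`;
    -- this bounds the variation integrals uniformly in `n`, and Fatou's lemma passes to `f`.
    have hb : ∀ n, ∫⁻ x, ‖F n x‖ₑ ∂ρ.variation ≤ 4 * c := by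
      intro n
      rw [← setLIntegral_univ]
      refine lintegral_variation_le (F n).integrable_of_isFiniteMeasure MeasurableSet.univ
        fun A _ hA => ?_
      rw [← cintegral_indicator hA, (hind n A hA).2]
      refine (x'.le_opENorm _).trans ?_
      rw [hc]
      gcongr
      refine (T.le_opENorm _).trans ?_
      gcongr
      rw [enorm_ofFun ((hFm n).indicator hA) (hind n A hA).1]
      exact eLux_mono (ae_of_all _ fun x => (norm_indicator_le_norm_self _ _).trans (hFle n x))
    refine lt_of_le_of_lt ?_ (ENNReal.mul_lt_top (a := 4) (b := c) (by simp)
      (ENNReal.mul_lt_top enorm_lt_top (ENNReal.mul_lt_top enorm_lt_top h2f)))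
    calc ∫⁻ x, ‖f x‖ₑ ∂ρ.variation
        = ∫⁻ x, liminf (fun n => ‖F n x‖ₑ) atTop ∂ρ.variation := by
          refine lintegral_congr fun x => ?_
          exact ((hFlim x).enorm.liminf_eq).symm
      _ ≤ liminf (fun n => ∫⁻ x, ‖F n x‖ₑ ∂ρ.variation) atTop :=
          lintegral_liminf_le fun n => (F n).measurable.enorm
      _ ≤ 4 * c := liminf_le_of_le (by isBoundedDefault) fun b hb' => by
          obtain ⟨n, hn⟩ := hb'.exists
          exact hn.trans (hb n)
  refine ⟨hint, fun A hA => ?_⟩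
  rw [← cintegral_indicator hA]
  have hlim1 : Tendsto (fun n => cintegral ρ (A.indicator (F n))) atTop
      (𝓝 (cintegral ρ (A.indicator f))) := by
    refine VectorMeasure.tendsto_integral_of_dominated_convergence (fun x => ‖((2 : ℂ) • f) x‖)
      (fun n => ((F n).stronglyMeasurable.indicator hA).aestronglyMeasurable)
      (hint.smul (2 : ℂ)).norm
      (fun n => ae_of_all _ fun x => (norm_indicator_le_norm_self _ _).trans (hFle n x))
      (ae_of_all _ fun x => ?_)
    by_cases hx : x ∈ A
    · simpa [hx] using hFlim x
    · simp [hx]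
  have hAf : eLux Φ m (A.indicator f) < ⊤ := (eLux_indicator_le A).trans_lt hf'
  have hlim2 : Tendsto (fun n => ofFun Φ m (A.indicator (F n))) atTop
      (𝓝 (ofFun Φ m (A.indicator f))) := by
    rw [tendsto_iff_norm_sub_tendsto_zero, ← tendsto_zero_iff_norm_tendsto_zero,
      tendsto_zero_iff_enorm_tendsto_zero]
    have hmeas : ∀ n, AEStronglyMeasurable (A.indicator (F n) - A.indicator f) m := fun n =>
      ((hFm n).indicator hA).sub (hf.aestronglyMeasurable.indicator hA)
    -- The difference is at most `3 |f|`; the constant is rounded up to `4` so that two doublings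
    -- suffice.
    have hle3 : ∀ n x, ‖(A.indicator (F n) - A.indicator f) x‖ ≤ ‖((2 : ℂ) • (2 : ℂ) • f) x‖ := by
      intro n x
      have h1 := hFle n x
      by_cases hx : x ∈ A
      · simp only [Pi.sub_apply, Set.indicator_of_mem hx, Pi.smul_apply, norm_smul] at h1 ⊢
        refine (norm_sub_le _ _).trans ?_
        have h2 : ‖(2 : ℂ)‖ = 2 := by simp
        rw [h2] at h1 ⊢
        linarith [norm_nonneg (f x)]
      · simp [hx]
    have h4f : eLux Φ m ((2 : ℂ) • (2 : ℂ) • f) < ⊤ :=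
      eLux_two_smul_le.trans_lt (ENNReal.mul_lt_top (by simp) h2f)
    refine (tendsto_eLux_of_dominated hfin hΦ h4f hmeas (fun n => ae_of_all _ (hle3 n))
      (ae_of_all _ fun x => ?_)).congr fun n => ?_
    · by_cases hx : x ∈ A
      · simpa [hx] using (hFlim x).sub_const (f x)
      · simp [hx]
    · rw [← ofFun_sub ((hFm n).indicator hA) (hind n A hA).1
        (hf.aestronglyMeasurable.indicator hA) hAf, enorm_ofFun (hmeas n)
        ((eLux_mono (ae_of_all _ (hle3 n))).trans_lt h4f)]
  refine tendsto_nhds_unique hlim1 ?_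
  simp_rw [fun n => (hind n A hA).2]
  exact ((x'.continuous.comp T.continuous).tendsto _).comp hlim2

theorem hasVectorIntegral_operatorMeasure {f : α → ℂ} (hf : StronglyMeasurable f)
    (hf' : eLux Φ m f < ⊤) {A : Set α} (hA : MeasurableSet A) :
    HasVectorIntegral (operatorMeasure hfin hΦ T) f A (T (ofFun Φ m (A.indicator f))) :=
  fun x' => (integrable_and_cintegral_pairing x' hf hf').2 A hA

theorem memL1_operatorMeasure {f : α → ℂ} (hf : StronglyMeasurable f)
    (hf' : eLux Φ m f < ⊤) : MemL1 (operatorMeasure hfin hΦ T) f :=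
  memL1_of_forall_exists (fun x' => (integrable_and_cintegral_pairing x' hf hf').1)
    fun _ hA => ⟨_, hasVectorIntegral_operatorMeasure hf hf' hA⟩

theorem integrationOp_operatorMeasure {f : α → ℂ} (hf : StronglyMeasurable f)
    (hf' : eLux Φ m f < ⊤) :
    integrationOp (operatorMeasure hfin hΦ T) f = T (ofFun Φ m f) := by
  have h := hasVectorIntegral_operatorMeasure (hfin := hfin) (hΦ := hΦ) (T := T) hf hf'
    MeasurableSet.univ
  rw [Set.indicator_univ] at h
  exact integrationOp_eq (memL1_operatorMeasure hf hf') h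

end OperatorMeasure

/-! ### Translates of continuous functions and of null sets. -/

section Translates

variable {G : Type*} [Group G] [TopologicalSpace G] [IsTopologicalGroup G]
  [CompactSpace G] [MeasurableSpace G] [BorelSpace G]

omit [Group G] [IsTopologicalGroup G] in
theorem integrable_of_continuous {E : Type*} [NormedAddCommGroup E] {g : G → E}
    (hg : Continuous g) (l : Measure G) [IsFiniteMeasureOnCompacts l] : Integrable g l :=
  hg.integrable_of_hasCompactSupport (HasCompactSupport.of_compactSpace g)

variable {E : Type*} [NormedAddCommGroup E] [NormedSpace ℝ E]

/-- The continuous map `t ↦ (s ↦ g(s⁻¹ t))` from `G` to `C(G, E)`. -/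
def translates (g : C(G, E)) : C(G, C(G, E)) :=
  ContinuousMap.curry ⟨fun p : G × G => g (p.2⁻¹ * p.1), by fun_prop⟩

theorem continuous_integral_translates (g : C(G, E)) (l : Measure G) [IsFiniteMeasure l] :
    Continuous fun t => ∫ s, g (s⁻¹ * t) ∂l := by
  have h : Continuous (Function.uncurry fun t s : G => g (s⁻¹ * t)) := by
    unfold Function.uncurry
    fun_prop
  rw [← continuousOn_univ]
  exact continuousOn_integral_of_compact_support isCompact_univ h.continuousOn
    fun _ x _ hx => absurd (Set.mem_univ x) hx

/-- A continuous functional on `C(G, E)` commutes with averaging over translates. -/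
theorem integral_clm_translates [CompleteSpace E] {F : Type*} [NormedAddCommGroup F]
    [NormedSpace ℝ F] [CompleteSpace F] (m : Measure G) [m.IsHaarMeasure]
    (L : C(G, E) →L[ℝ] F) (g : C(G, E)) :
    ∫ t, L (translates g t) ∂m = L (ContinuousMap.const G (∫ t, g t ∂m)) := by
  -- The translates are averaged as a Bochner integral in `C(G, E)`, which commutes with `L`;
  -- evaluation at `s` and left invariance show that the average is constant.
  have hint : Integrable (translates g) m := integrable_of_continuous (translates g).continuous m
  rw [L.integral_comp_comm hint]
  congr 1
  ext s
  rw [ContinuousMap.integral_apply hint, ContinuousMap.const_apply]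
  exact integral_mul_left_eq_self (μ := m) (fun t => g t) s⁻¹

theorem integral_integral_translates [CompleteSpace E] (m l : Measure G) [m.IsHaarMeasure]
    [IsFiniteMeasure l] (g : C(G, E)) :
    ∫ t, ∫ s, g (s⁻¹ * t) ∂l ∂m = l.real Set.univ • ∫ t, g t ∂m := by
  rw [integral_integral_swap_of_hasCompactSupport (by unfold Function.uncurry; fun_prop)
    (HasCompactSupport.of_compactSpace _)]
  have : ∀ s : G, ∫ t, g (s⁻¹ * t) ∂m = ∫ t, g t ∂m := fun s =>
    integral_mul_left_eq_self (μ := m) (fun t => g t) s⁻¹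
  simp_rw [this, integral_const]

variable [T2Space G]

/-- The weak-type estimate for the translates of an open set. -/
theorem measure_translates_open_le (m l : Measure G) [m.IsHaarMeasure] [m.Regular] [l.Regular]
    {U : Set G} (hU : IsOpen U) {c : ℝ} (hc : 0 < c) :
    m {t | c < l.real {s | s⁻¹ * t ∈ U}}
      ≤ ENNReal.ofReal (l.real Set.univ * m.real U / c) := by
  set V : Set G := {t | c < l.real {s | s⁻¹ * t ∈ U}} with hV
  let J : C(G, ℝ) → G → ℝ := fun g t => ∫ s, g (s⁻¹ * t) ∂l
  have hJ : ∀ g, Continuous (J g) := fun g => continuous_integral_translates g l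
  -- The continuous functions between `0` and the indicator of `U`: the double integral of their
  -- translates can be computed, unlike that of the indicator.
  let P : C(G, ℝ) → Prop := fun g => (∀ x, 0 ≤ g x) ∧ ∀ x, g x ≤ U.indicator 1 x
  have hint : ∀ (g : C(G, ℝ)) (t : G), Integrable (fun s => g (s⁻¹ * t)) l := fun g t =>
    integrable_of_continuous (by fun_prop) l
  have hW : ∀ t : G, IsOpen {s | s⁻¹ * t ∈ U} := fun t => hU.preimage (by fun_prop)
  have hJle : ∀ g, P g → ∀ t, J g t ≤ l.real {s | s⁻¹ * t ∈ U} := by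
    intro g hg t
    rw [← integral_indicator_one (hW t).measurableSet]
    refine integral_mono (hint g t) ((integrable_const 1).indicator (hW t).measurableSet)
      fun s => ?_
    refine (hg.2 _).trans_eq ?_
    by_cases hs : s⁻¹ * t ∈ U <;> simp [hs]
  -- Inner regularity of `l` gives a compact part of `{s | s⁻¹ * t ∈ U}` of measure above `c`; a
  -- Urysohn function equal to `1` on its image serves as `g`.
  have hloc : ∀ t ∈ V, ∃ g, P g ∧ c < J g t := by
    intro t ht
    have ht' : ENNReal.ofReal c < l {s | s⁻¹ * t ∈ U} :=
      (ENNReal.ofReal_lt_iff_lt_toReal hc.le (measure_ne_top _ _)).2 ht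
    obtain ⟨C, hCW, hC, hcC⟩ := (hW t).exists_lt_isCompact ht'
    have hC' : IsCompact ((fun s : G => s⁻¹ * t) '' C) := hC.image (by fun_prop)
    obtain ⟨g, hg0, hg1, hg⟩ := exists_continuous_zero_one_of_isClosed hU.isClosed_compl
      hC'.isClosed (Set.disjoint_compl_left_iff_subset.2 (Set.image_subset_iff.2 hCW))
    refine ⟨g, ⟨fun x => (hg x).1, fun x => ?_⟩, ?_⟩
    · by_cases hx : x ∈ U
      · simpa [hx] using (hg x).2
      · simpa [hx] using (hg0 hx).le
    · refine ((ENNReal.ofReal_lt_iff_lt_toReal hc.le (measure_ne_top _ _)).1 hcC).trans_le ?_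
      change l.real C ≤ _
      rw [← integral_indicator_one hC.measurableSet]
      refine integral_mono ((integrable_const 1).indicator hC.measurableSet) (hint g t)
        fun s => ?_
      by_cases hs : s ∈ C
      · simpa [hs] using (hg1 ⟨s, hs, rfl⟩).ge
      · simpa [hs] using (hg _).1
  have hVo : IsOpen V := by
    refine isOpen_iff_mem_nhds.2 fun t ht => ?_
    obtain ⟨g, hg, hgt⟩ := hloc t ht
    filter_upwards [(hJ g).continuousAt.eventually (lt_mem_nhds hgt)] with t' ht'
    exact ht'.trans_le (hJle g hg t')
  rw [hVo.measure_eq_iSup_isCompact]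
  refine iSup₂_le fun K hKV => iSup_le fun hK => ?_
  -- Compactness needs only finitely many local minorants, and their maximum is again a minorant.
  -- Markov's inequality for this single `g` then bounds `m K`.
  obtain ⟨g, hg, hgK⟩ : ∃ g, P g ∧ ∀ t ∈ K, c < J g t := by
    refine hK.induction_on (p := fun K' => ∃ g, P g ∧ ∀ t ∈ K', c < J g t) ?_ ?_ ?_ ?_
    · exact ⟨0, ⟨fun _ => le_rfl, fun x => Set.indicator_nonneg (fun _ _ => zero_le_one) x⟩,
        fun _ h => h.elim⟩
    · rintro s t hst ⟨g, hg, h⟩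
      exact ⟨g, hg, fun x hx => h x (hst hx)⟩
    · rintro s t ⟨g, hg, h⟩ ⟨g', hg', h'⟩
      refine ⟨g ⊔ g', ⟨fun x => le_sup_of_le_left (hg.1 x), fun x => sup_le (hg.2 x) (hg'.2 x)⟩,
        ?_⟩
      rintro x (hx | hx)
      · exact (h x hx).trans_le (integral_mono (hint _ _) (hint _ _) fun s => le_sup_left)
      · exact (h' x hx).trans_le (integral_mono (hint _ _) (hint _ _) fun s => le_sup_right)
    · intro t ht
      obtain ⟨g, hg, hgt⟩ := hloc t (hKV ht)
      exact ⟨{t' | c < J g t'}, mem_nhdsWithin_of_mem_nhds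
        ((hJ g).continuousAt.eventually (lt_mem_nhds hgt)), g, hg, fun _ h => h⟩
  have hmK : c * m.real K ≤ l.real Set.univ * m.real U := by
    calc c * m.real K ≤ c * m.real {t | c ≤ J g t} := by
          gcongr
          · exact measure_ne_top _ _
          · exact fun t ht => (hgK t ht).le
      _ ≤ ∫ t, J g t ∂m := mul_meas_ge_le_integral_of_nonneg
          (ae_of_all _ fun t => integral_nonneg fun s => hg.1 _)
          (integrable_of_continuous (hJ g) m) c
      _ = l.real Set.univ * ∫ t, g t ∂m := integral_integral_translates m l g
      _ ≤ l.real Set.univ * m.real U := by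
          rw [← integral_indicator_one hU.measurableSet]
          gcongr
          · exact integrable_of_continuous g.continuous m
          · exact (integrable_const 1).indicator hU.measurableSet
          · exact fun x => hg.2 x
  rw [← ENNReal.ofReal_toReal (measure_ne_top m K)]
  refine ENNReal.ofReal_le_ofReal ?_
  rwa [le_div_iff₀ hc, mul_comm]

/-- Almost every translate of an almost everywhere property holds almost everywhere. -/
theorem ae_ae_translates (m l : Measure G) [m.IsHaarMeasure] [m.Regular] [l.Regular]
    {p : G → Prop} (hp : ∀ᵐ x ∂m, p x) : ∀ᵐ t ∂m, ∀ᵐ s ∂l, p (s⁻¹ * t) := by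
  have key : ∀ n : ℕ, m {t | (1 : ℝ) / (n + 1) < l.real {s | s⁻¹ * t ∈ {x | ¬ p x}}} = 0 := by
    intro n
    set c : ℝ := 1 / (n + 1) with hc
    have hc0 : 0 < c := by positivity
    have hlim : Tendsto (fun ε : ℝ => ENNReal.ofReal (l.real Set.univ * ε / c)) (𝓝[>] 0)
        (𝓝 0) := by
      have : Tendsto (fun ε : ℝ => ENNReal.ofReal (l.real Set.univ * ε / c)) (𝓝 0)
          (𝓝 (ENNReal.ofReal (l.real Set.univ * 0 / c))) :=
        ENNReal.tendsto_ofReal (Continuous.tendsto (by fun_prop) 0)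
      rw [mul_zero, zero_div, ENNReal.ofReal_zero] at this
      exact this.mono_left nhdsWithin_le_nhds
    refine le_antisymm (ge_of_tendsto hlim ?_) zero_le
    filter_upwards [self_mem_nhdsWithin] with ε hε
    have hε' : ENNReal.ofReal ε ≠ 0 := (ENNReal.ofReal_pos.2 hε).ne'
    -- Outer regularity encloses the exceptional set in an open set of measure below `ε`, where the
    -- weak-type estimate applies.
    obtain ⟨U, hNU, hU, hmU⟩ := Set.exists_isOpen_lt_add (μ := m) {x | ¬ p x}
      (measure_ne_top _ _) hε'
    rw [ae_iff.1 hp, zero_add] at hmU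
    have hmU' : m.real U ≤ ε := ENNReal.toReal_le_of_le_ofReal (le_of_lt hε) hmU.le
    calc m {t | c < l.real {s | s⁻¹ * t ∈ {x | ¬ p x}}}
        ≤ m {t | c < l.real {s | s⁻¹ * t ∈ U}} := by
          refine measure_mono fun t (ht : c < _) => show c < _ from ht.trans_le ?_
          exact measureReal_mono (fun s hs => hNU hs)
      _ ≤ ENNReal.ofReal (l.real Set.univ * m.real U / c) := measure_translates_open_le m l hU hc0
      _ ≤ ENNReal.ofReal (l.real Set.univ * ε / c) := by gcongr
  have hall : ∀ᵐ t ∂m, ∀ n : ℕ, ¬ (1 : ℝ) / (n + 1) < l.real {s | s⁻¹ * t ∈ {x | ¬ p x}} := by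
    rw [ae_all_iff]
    intro n
    rw [ae_iff]
    simpa only [not_not] using key n
  filter_upwards [hall] with t ht
  rw [ae_iff]
  by_contra h0
  have hpos : 0 < l.real {s | ¬ p (s⁻¹ * t)} := ENNReal.toReal_pos h0 (measure_ne_top _ _)
  obtain ⟨n, hn⟩ := exists_nat_one_div_lt hpos
  exact ht n hn

end Translates

/-! ### Integrability of almost every translate for a positive measure. -/

section Convolution

variable {G : Type*} [Group G] [TopologicalSpace G] [IsTopologicalGroup G]
  [CompactSpace G] [T2Space G] [MeasurableSpace G] [BorelSpace G]
  {m l : Measure G} [m.IsHaarMeasure] [m.Regular] [l.Regular] {f : G → ℂ}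

omit [m.IsHaarMeasure] in
/-- An integrable function is rapidly approximated in `L¹` by continuous functions. -/
theorem exists_continuous_approx (hf : Integrable f m) :
    ∃ g : ℕ → C(G, ℂ), ∑' n, ∫⁻ x, ‖g n x - f x‖ₑ ∂m ≠ ⊤ := by
  have h : ∀ n : ℕ, ∃ g : C(G, ℂ), ∫⁻ x, ‖g x - f x‖ₑ ∂m ≤ (2 : ℝ≥0∞)⁻¹ ^ n := by
    intro n
    obtain ⟨g, -, hle, hg, hgi⟩ := hf.exists_hasCompactSupport_integral_sub_le
      (ε := (1 / 2 : ℝ) ^ n) (by positivity)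
    refine ⟨⟨g, hg⟩, ?_⟩
    have h1 : ∫⁻ x, ‖g x - f x‖ₑ ∂m = ENNReal.ofReal (∫ x, ‖f x - g x‖ ∂m) := by
      refine (lintegral_congr fun x => enorm_sub_rev _ _).trans ?_
      exact (ofReal_integral_norm_eq_lintegral_enorm (hf.sub hgi)).symm
    change ∫⁻ x, ‖g x - f x‖ₑ ∂m ≤ _
    rw [h1]
    refine (ENNReal.ofReal_le_ofReal hle).trans_eq ?_
    rw [ENNReal.ofReal_pow (by norm_num), one_div, ENNReal.ofReal_inv_of_pos two_pos,
      ENNReal.ofReal_ofNat]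
  choose g hg using h
  refine ⟨g, ((ENNReal.tsum_le_tsum hg).trans_lt ?_).ne⟩
  rw [ENNReal.tsum_geometric, ENNReal.one_sub_inv_two, inv_inv]
  exact ENNReal.ofNat_lt_top

omit [T2Space G] [m.Regular] in
theorem lintegral_translates_continuous (g : C(G, ℂ)) :
    (Continuous fun t => ∫⁻ s, ‖g (s⁻¹ * t)‖ₑ ∂l) ∧
      ∫⁻ t, ∫⁻ s, ‖g (s⁻¹ * t)‖ₑ ∂l ∂m = l Set.univ * ∫⁻ t, ‖g t‖ₑ ∂m := by
  let u : C(G, ℝ) := ⟨fun x => ‖g x‖, by fun_prop⟩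
  have h1 : ∀ t, ∫⁻ s, ‖g (s⁻¹ * t)‖ₑ ∂l = ENNReal.ofReal (∫ s, u (s⁻¹ * t) ∂l) := fun t =>
    (ofReal_integral_norm_eq_lintegral_enorm
      (integrable_of_continuous (g := fun s => g (s⁻¹ * t)) (by fun_prop) l)).symm
  have hc : Continuous fun t => ∫ s, u (s⁻¹ * t) ∂l := continuous_integral_translates u l
  simp_rw [h1]
  refine ⟨ENNReal.continuous_ofReal.comp hc, ?_⟩
  rw [← ofReal_integral_eq_lintegral_ofReal (integrable_of_continuous hc m)
    (ae_of_all _ fun t => integral_nonneg fun s => norm_nonneg (g (s⁻¹ * t))),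
    integral_integral_translates, smul_eq_mul, ENNReal.ofReal_mul measureReal_nonneg,
    ofReal_measureReal]
  congr 1
  exact ofReal_integral_norm_eq_lintegral_enorm (integrable_of_continuous g.continuous m)

/-- Rapid `L¹`-approximation by continuous functions passes to almost every translate. -/
theorem ae_tendsto_translates (hf : Integrable f m) {g : ℕ → C(G, ℂ)}
    (hg : ∑' n, ∫⁻ x, ‖g n x - f x‖ₑ ∂m ≠ ⊤) :
    ∀ᵐ t ∂m, Integrable (fun s => f (s⁻¹ * t)) l ∧
      Tendsto (fun n => ∫⁻ s, ‖g n (s⁻¹ * t) - f (s⁻¹ * t)‖ₑ ∂l) atTop (𝓝 0) := by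
  have hlim : ∀ᵐ x ∂m, Tendsto (fun n => g n x) atTop (𝓝 (f x)) := by
    have hmeas : ∀ n, AEMeasurable (fun x => ‖g n x - f x‖ₑ) m := fun n =>
      (((g n).continuous.aestronglyMeasurable).sub hf.aestronglyMeasurable).enorm
    rw [← lintegral_tsum hmeas] at hg
    filter_upwards [ae_lt_top' (AEMeasurable.tsum hmeas) hg] with x hx
    have := ENNReal.tendsto_atTop_zero_of_tsum_ne_top hx.ne
    rw [tendsto_iff_edist_tendsto_0]
    simpa only [edist_eq_enorm_sub] using this
  -- Only the increments are continuous and hence accessible to Fubini. Their translates are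
  -- summable for almost every `t`, so the tails dominate the distance to the translate of `f`.
  let u : ℕ → C(G, ℂ) := fun n => g n - g (n + 1)
  have hu : ∑' n, ∫⁻ x, ‖u n x‖ₑ ∂m ≠ ⊤ := by
    have hle : ∀ n, ∫⁻ x, ‖u n x‖ₑ ∂m
        ≤ ∫⁻ x, ‖g n x - f x‖ₑ ∂m + ∫⁻ x, ‖g (n + 1) x - f x‖ₑ ∂m := by
      intro n
      have hm : AEMeasurable (fun x => ‖g n x - f x‖ₑ) m :=
        (((g n).continuous.aestronglyMeasurable).sub hf.aestronglyMeasurable).enorm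
      rw [← lintegral_add_left' hm]
      refine lintegral_mono fun x => ?_
      have : u n x = (g n x - f x) - (g (n + 1) x - f x) := by
        simp only [u, ContinuousMap.sub_apply]; ring
      rw [this]
      exact enorm_sub_le
    refine ((ENNReal.tsum_le_tsum hle).trans_lt ?_).ne
    rw [ENNReal.tsum_add]
    refine ENNReal.add_lt_top.2 ⟨hg.lt_top, lt_of_le_of_lt ?_ hg.lt_top⟩
    exact ENNReal.tsum_comp_le_tsum_of_injective (add_left_injective 1)
      (fun n => ∫⁻ x, ‖g n x - f x‖ₑ ∂m)
  have hfin : ∀ᵐ t ∂m, ∑' n, ∫⁻ s, ‖u n (s⁻¹ * t)‖ₑ ∂l < ⊤ := by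
    have hm : ∀ n, AEMeasurable (fun t => ∫⁻ s, ‖u n (s⁻¹ * t)‖ₑ ∂l) m := fun n =>
      (lintegral_translates_continuous (m := m) (u n)).1.aemeasurable
    refine ae_lt_top' (AEMeasurable.tsum hm) ?_
    rw [lintegral_tsum hm]
    simp_rw [(lintegral_translates_continuous (m := m) (l := l) (u _)).2]
    rw [ENNReal.tsum_mul_left]
    exact ENNReal.mul_ne_top (measure_ne_top _ _) hu
  filter_upwards [ae_ae_translates m l hlim, hfin] with t ht1 ht2
  have hcont : ∀ n, Continuous fun s => g n (s⁻¹ * t) := fun n => by fun_prop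
  -- Measurability of the translate with respect to `l` is not known in advance; it comes from being
  -- an almost everywhere limit of continuous functions.
  have hmeas : AEStronglyMeasurable (fun s => f (s⁻¹ * t)) l :=
    aestronglyMeasurable_of_tendsto_ae atTop (fun n => (hcont n).aestronglyMeasurable) ht1
  have hbound : ∀ n, ∫⁻ s, ‖g n (s⁻¹ * t) - f (s⁻¹ * t)‖ₑ ∂l
      ≤ ∑' k, ∫⁻ s, ‖u (k + n) (s⁻¹ * t)‖ₑ ∂l := by
    intro n
    rw [← lintegral_tsum fun k => (Continuous.enorm (by fun_prop)).aemeasurable]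
    refine lintegral_mono_ae ?_
    filter_upwards [ht1] with s hs
    have := edist_le_tsum_of_edist_le_of_tendsto (fun k => ‖u k (s⁻¹ * t)‖ₑ)
      (fun k => (edist_eq_enorm_sub _ _).le) hs n
    rw [edist_eq_enorm_sub] at this
    simpa only [add_comm] using this
  have htail := ENNReal.tendsto_sum_nat_add _ ht2.ne
  refine ⟨⟨hmeas, ?_⟩, tendsto_of_tendsto_of_tendsto_of_le_of_le tendsto_const_nhds htail
    (fun _ => zero_le) hbound⟩
  have h0 : ∫⁻ s, ‖g 0 (s⁻¹ * t) - f (s⁻¹ * t)‖ₑ ∂l < ⊤ := (hbound 0).trans_lt (by simpa using ht2)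
  have h1 : Integrable (fun s => g 0 (s⁻¹ * t)) l := integrable_of_continuous (hcont 0) l
  have h2 : Integrable (fun s => g 0 (s⁻¹ * t) - f (s⁻¹ * t)) l :=
    ⟨(hcont 0).aestronglyMeasurable.sub hmeas, h0⟩
  exact ((h1.sub h2).congr (ae_of_all _ fun s => by simp)).2

theorem ae_integrable_translates (hf : Integrable f m) :
    ∀ᵐ t ∂m, Integrable (fun s => f (s⁻¹ * t)) l := by
  obtain ⟨g, hg⟩ := exists_continuous_approx hf
  exact (ae_tendsto_translates hf hg).mono fun t ht => ht.1

/-- This replaces Tonelli's theorem: for almost every `t` the inner integral is the limit of those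
of continuous approximants, and Fatou's lemma gives the inequality. -/
theorem lintegral_lintegral_translates_le (hf : Integrable f m) :
    ∫⁻ t, ∫⁻ s, ‖f (s⁻¹ * t)‖ₑ ∂l ∂m ≤ l Set.univ * ∫⁻ t, ‖f t‖ₑ ∂m := by
  obtain ⟨g, hg⟩ := exists_continuous_approx hf
  have hle : ∀ᵐ t ∂m, ∫⁻ s, ‖f (s⁻¹ * t)‖ₑ ∂l
      ≤ liminf (fun n => ∫⁻ s, ‖g n (s⁻¹ * t)‖ₑ ∂l) atTop := by
    filter_upwards [ae_tendsto_translates (l := l) hf hg] with t ht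
    have h1 : Tendsto (fun n => ∫ s, ‖g n (s⁻¹ * t)‖ ∂l) atTop (𝓝 (∫ s, ‖f (s⁻¹ * t)‖ ∂l)) := by
      refine tendsto_integral_of_L1 _ ht.1.norm.aestronglyMeasurable (Eventually.of_forall
        fun n => integrable_of_continuous (by fun_prop) l) ?_
      refine tendsto_of_tendsto_of_tendsto_of_le_of_le tendsto_const_nhds ht.2
        (fun _ => zero_le) fun n => lintegral_mono fun s => ?_
      rw [← ofReal_norm, ← ofReal_norm, Real.norm_eq_abs]
      exact ENNReal.ofReal_le_ofReal (abs_norm_sub_norm_le _ _)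
    have h2 := ENNReal.tendsto_ofReal h1
    rw [ofReal_integral_norm_eq_lintegral_enorm ht.1] at h2
    refine (h2.congr fun n => ?_).liminf_eq.ge
    exact ofReal_integral_norm_eq_lintegral_enorm (integrable_of_continuous (by fun_prop) l)
  have hlim : Tendsto (fun n => ∫⁻ t, ‖g n t‖ₑ ∂m) atTop (𝓝 (∫⁻ t, ‖f t‖ₑ ∂m)) := by
    have h0 := ENNReal.tendsto_atTop_zero_of_tsum_ne_top hg
    have h1 : Tendsto (fun n => ∫ s, ‖g n s‖ ∂m) atTop (𝓝 (∫ s, ‖f s‖ ∂m)) := by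
      refine tendsto_integral_of_L1 _ hf.norm.aestronglyMeasurable (Eventually.of_forall
        fun n => integrable_of_continuous (by fun_prop) m) ?_
      refine tendsto_of_tendsto_of_tendsto_of_le_of_le tendsto_const_nhds h0
        (fun _ => zero_le) fun n => lintegral_mono fun s => ?_
      rw [← ofReal_norm, ← ofReal_norm, Real.norm_eq_abs]
      exact ENNReal.ofReal_le_ofReal (abs_norm_sub_norm_le _ _)
    have h2 := ENNReal.tendsto_ofReal h1
    rw [ofReal_integral_norm_eq_lintegral_enorm hf] at h2
    exact h2.congr fun n => ofReal_integral_norm_eq_lintegral_enorm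
      (integrable_of_continuous (by fun_prop) m)
  calc ∫⁻ t, ∫⁻ s, ‖f (s⁻¹ * t)‖ₑ ∂l ∂m
      ≤ ∫⁻ t, liminf (fun n => ∫⁻ s, ‖g n (s⁻¹ * t)‖ₑ ∂l) atTop ∂m := lintegral_mono_ae hle
    _ ≤ liminf (fun n => ∫⁻ t, ∫⁻ s, ‖g n (s⁻¹ * t)‖ₑ ∂l ∂m) atTop :=
        lintegral_liminf_le fun n =>
          (lintegral_translates_continuous (m := m) (g n)).1.measurable
    _ = l Set.univ * ∫⁻ t, ‖f t‖ₑ ∂m := by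
        simp_rw [(lintegral_translates_continuous (m := m) (l := l) (g _)).2]
        exact (ENNReal.Tendsto.const_mul hlim (Or.inr (measure_ne_top _ _))).liminf_eq

end Convolution

/-! ### Convolution by a complex measure on `L¹(m)`. -/

section ConvComplex

variable {G : Type*} [Group G]

theorem enorm_conv_le [MeasurableSpace G] (μ : ComplexMeasure G) (f : G → ℂ) (t : G) :
    ‖conv μ f t‖ₑ ≤ ∫⁻ s, ‖f (s⁻¹ * t)‖ₑ ∂μ.variation :=
  enorm_cintegral_le _ _

theorem norm_conv_le [MeasurableSpace G] (μ : ComplexMeasure G) (f : G → ℂ) (t : G) :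
    ‖conv μ f t‖ ≤ ∫ s, ‖f (s⁻¹ * t)‖ ∂μ.variation :=
  norm_cintegral_le _ _

theorem conv_const_smul [MeasurableSpace G] (μ : ComplexMeasure G) (c : ℂ) (f : G → ℂ) :
    conv μ (c • f) = c • conv μ f :=
  funext fun _ => cintegral_const_mul c _

variable [TopologicalSpace G] [IsTopologicalGroup G]
  [CompactSpace G] [MeasurableSpace G] [BorelSpace G] {μ : ComplexMeasure G}

/-- Integration against a complex measure as a functional on `C(G)`. -/
def cintegralCLM (μ : ComplexMeasure G) : C(G, ℂ) →L[ℝ] ℂ :=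
  have := isFiniteMeasure_variation μ
  LinearMap.mkContinuous
    { toFun := fun g => cintegral μ g
      map_add' := fun g h => cintegral_add (integrable_of_continuous g.continuous _)
        (integrable_of_continuous h.continuous _)
      map_smul' := fun c g => VectorMeasure.integral_fun_smul μ (ContinuousLinearMap.mul ℝ ℂ) c g }
    (μ.variation.real Set.univ) fun g => by
      refine (norm_cintegral_le μ g).trans ?_
      calc ∫ x, ‖g x‖ ∂μ.variation ≤ ∫ _, ‖g‖ ∂μ.variation :=
            integral_mono (integrable_of_continuous g.continuous _).norm (integrable_const _)
              fun x => g.norm_coe_le_norm x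
        _ = μ.variation.real Set.univ * ‖g‖ := by rw [integral_const, smul_eq_mul]

theorem conv_eq_cintegralCLM (g : C(G, ℂ)) (t : G) :
    conv μ g t = cintegralCLM μ (translates g t) := rfl

theorem continuous_conv (g : C(G, ℂ)) : Continuous (conv μ g) :=
  ((cintegralCLM μ).continuous.comp (translates g).continuous).congr
    fun t => (conv_eq_cintegralCLM g t).symm

variable {m : Measure G} [m.IsHaarMeasure]

/-- Integration against `μ` is a continuous functional on `C(G)`, so `integral_clm_translates`
applies; on constants it gives the factor `μ(G)`. -/
theorem integral_conv_continuous (g : C(G, ℂ)) :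
    ∫ t, conv μ g t ∂m = μ Set.univ * ∫ t, g t ∂m := by
  have := isFiniteMeasure_variation μ
  simp_rw [conv_eq_cintegralCLM]
  rw [integral_clm_translates]
  have h := VectorMeasure.integral_const (μ := μ) (B := ContinuousLinearMap.mul ℝ ℂ)
    (∫ t, g t ∂m)
  exact h.trans (mul_comm _ _)

variable [T2Space G] [m.Regular] {f g : G → ℂ} [μ.variation.Regular]

theorem conv_congr (h : f =ᵐ[m] g) : conv μ f =ᵐ[m] conv μ g :=
  (ae_ae_translates m μ.variation h).mono fun _ ht => cintegral_congr ht

theorem conv_add (hf : Integrable f m) (hg : Integrable g m) :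
    conv μ (f + g) =ᵐ[m] conv μ f + conv μ g := by
  filter_upwards [ae_integrable_translates (l := μ.variation) hf,
    ae_integrable_translates (l := μ.variation) hg] with t h1 h2
  exact cintegral_add h1 h2

theorem conv_sub (hf : Integrable f m) (hg : Integrable g m) :
    conv μ (f - g) =ᵐ[m] conv μ f - conv μ g := by
  filter_upwards [ae_integrable_translates (l := μ.variation) hf,
    ae_integrable_translates (l := μ.variation) hg] with t h1 h2
  exact cintegral_sub h1 h2

theorem aestronglyMeasurable_conv (hf : Integrable f m) : AEStronglyMeasurable (conv μ f) m := by
  obtain ⟨g, hg⟩ := exists_continuous_approx hf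
  refine aestronglyMeasurable_of_tendsto_ae atTop
    (fun n => (continuous_conv (μ := μ) (g n)).aestronglyMeasurable) ?_
  filter_upwards [ae_tendsto_translates (l := μ.variation) hf hg] with t ht
  exact VectorMeasure.tendsto_integral_of_L1 _ ht.1.aestronglyMeasurable
    (Eventually.of_forall fun n => integrable_of_continuous (by fun_prop) _) ht.2

theorem lintegral_conv_le (hf : Integrable f m) :
    ∫⁻ t, ‖conv μ f t‖ₑ ∂m ≤ μ.variation Set.univ * ∫⁻ t, ‖f t‖ₑ ∂m :=
  (lintegral_mono fun t => enorm_conv_le μ f t).trans (lintegral_lintegral_translates_le hf)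

theorem integrable_conv (hf : Integrable f m) : Integrable (conv μ f) m :=
  ⟨aestronglyMeasurable_conv hf, (lintegral_conv_le hf).trans_lt
    (ENNReal.mul_lt_top (measure_lt_top _ _) hf.2)⟩

/-- Convolution by a complex measure multiplies integrals by the total mass. -/
theorem integral_conv (hf : Integrable f m) :
    ∫ t, conv μ f t ∂m = μ Set.univ * ∫ t, f t ∂m := by
  obtain ⟨g, hg⟩ := exists_continuous_approx hf
  have h0 := ENNReal.tendsto_atTop_zero_of_tsum_ne_top hg
  have hgi : ∀ n, Integrable (g n) m := fun n => integrable_of_continuous (g n).continuous m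
  have h1 : Tendsto (fun n => ∫ t, g n t ∂m) atTop (𝓝 (∫ t, f t ∂m)) :=
    tendsto_integral_of_L1 _ hf.aestronglyMeasurable (Eventually.of_forall hgi) h0
  have h2 : Tendsto (fun n => ∫ t, conv μ (g n) t ∂m) atTop (𝓝 (∫ t, conv μ f t ∂m)) := by
    refine tendsto_integral_of_L1 _ (aestronglyMeasurable_conv hf) (Eventually.of_forall
      fun n => integrable_conv (hgi n)) ?_
    have h3 : Tendsto (fun n => μ.variation Set.univ * ∫⁻ x, ‖g n x - f x‖ₑ ∂m) atTop (𝓝 0) := by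
      simpa using ENNReal.Tendsto.const_mul h0 (Or.inr (measure_ne_top μ.variation Set.univ))
    refine tendsto_of_tendsto_of_tendsto_of_le_of_le tendsto_const_nhds h3
      (fun _ => zero_le) fun n => ?_
    refine le_trans (le_of_eq (lintegral_congr_ae ?_)) (lintegral_conv_le ((hgi n).sub hf))
    filter_upwards [conv_sub (μ := μ) (hgi n) hf] with t ht
    exact congrArg enorm ht.symm
  simp_rw [integral_conv_continuous] at h2
  exact tendsto_nhds_unique h2 (h1.const_mul _)

end ConvComplex

/-! ### Jensen's inequality for Young functions. -/

section Jensen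

variable {Φ : YoungFunction}

theorem YoungFunction.convexOn_toReal (hfin : ∀ x : ℝ≥0, Φ x ≠ ⊤) :
    ConvexOn ℝ (Set.Ici 0) fun x : ℝ => (Φ x.toNNReal).toReal := by
  refine ⟨convex_Ici 0, fun x hx y hy a b ha hb hab => ?_⟩
  lift a to ℝ≥0 using ha
  lift b to ℝ≥0 using hb
  lift x to ℝ≥0 using hx
  lift y to ℝ≥0 using hy
  have h := Φ.convex_le (a := a) (b := b) (x := x) (y := y) (by exact_mod_cast hab)
  have h' := ENNReal.toReal_mono (ENNReal.add_ne_top.2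
    ⟨ENNReal.mul_ne_top ENNReal.coe_ne_top (hfin x),
      ENNReal.mul_ne_top ENNReal.coe_ne_top (hfin y)⟩) h
  rw [ENNReal.toReal_add (ENNReal.mul_ne_top ENNReal.coe_ne_top (hfin x))
    (ENNReal.mul_ne_top ENNReal.coe_ne_top (hfin y)), ENNReal.toReal_mul, ENNReal.toReal_mul] at h'
  have e : ((a : ℝ) * (x : ℝ) + (b : ℝ) * (y : ℝ)).toNNReal = a * x + b * y := by
    exact_mod_cast Real.toNNReal_coe (r := a * x + b * y)
  simpa only [smul_eq_mul, e, Real.toNNReal_coe, ENNReal.coe_toReal] using h'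

/-- Convexity gives continuity in the interior only; the endpoint `0` is covered by the linear bound
for `Φ` near `0`. -/
theorem YoungFunction.continuousOn_toReal (hfin : ∀ x : ℝ≥0, Φ x ≠ ⊤) :
    ContinuousOn (fun x : ℝ => (Φ x.toNNReal).toReal) (Set.Ici 0) := by
  intro x hx
  rcases (Set.mem_Ici.1 hx).eq_or_lt with rfl | hx0
  · have h1 : Tendsto (fun x : ℝ => Φ x.toNNReal) (𝓝 0) (𝓝 0) := by
      refine (YoungFunction.tendsto_nhds_zero hfin).comp ?_
      simpa using continuous_real_toNNReal.tendsto (0 : ℝ)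
    have h2 := (ENNReal.tendsto_toReal ENNReal.zero_ne_top).comp h1
    refine ContinuousAt.continuousWithinAt ?_
    simpa [ContinuousAt, Φ.zero', Function.comp_def] using h2
  · have h := (YoungFunction.convexOn_toReal hfin).continuousOn_interior
    rw [interior_Ici] at h
    exact (h.continuousAt (Ioi_mem_nhds hx0)).continuousWithinAt

/-- Jensen's inequality for a finite Young function. -/
theorem YoungFunction.map_average_le (hfin : ∀ x : ℝ≥0, Φ x ≠ ⊤) {α : Type*} [MeasurableSpace α]
    {l : Measure α} [IsFiniteMeasure l] [NeZero l] {h : α → ℝ≥0}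
    (hi : Integrable (fun x => (h x : ℝ)) l) (hΦ : ∫⁻ x, Φ (h x) ∂l ≠ ⊤) :
    Φ (⨍ x, (h x : ℝ) ∂l).toNNReal ≤ (l Set.univ)⁻¹ * ∫⁻ x, Φ (h x) ∂l := by
  have hm : AEMeasurable h l := by simpa using hi.aestronglyMeasurable.aemeasurable.real_toNNReal
  have hΦm : AEMeasurable (fun x => Φ (h x)) l := Φ.mono.measurable.comp_aemeasurable hm
  have hΦi : Integrable (fun x => (Φ (h x)).toReal) l :=
    integrable_toReal_of_lintegral_ne_top hΦm hΦ
  have hJ := (YoungFunction.convexOn_toReal hfin).map_average_le (μ := l)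
    (f := fun x => (h x : ℝ)) (YoungFunction.continuousOn_toReal hfin) isClosed_Ici
    (ae_of_all _ fun x => NNReal.coe_nonneg _) hi
    (by simpa only [Function.comp_def, Real.toNNReal_coe] using hΦi)
  simp only [Real.toNNReal_coe] at hJ
  rw [average_eq l (fun x => (Φ (h x)).toReal), integral_toReal hΦm
    (ae_of_all _ fun x => (hfin _).lt_top)] at hJ
  have hl0 : l Set.univ ≠ 0 := by simpa using NeZero.ne l
  have htop : (l Set.univ)⁻¹ * ∫⁻ x, Φ (h x) ∂l ≠ ⊤ :=
    ENNReal.mul_ne_top (ENNReal.inv_ne_top.2 hl0) hΦ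
  rw [← ENNReal.toReal_le_toReal (hfin _) htop, ENNReal.toReal_mul, ENNReal.toReal_inv]
  exact hJ

end Jensen

/-! ### Boundedness of convolution on the Orlicz space. -/

section ConvolutionOperator

variable {G : Type*} [Group G] [TopologicalSpace G] [IsTopologicalGroup G]
  [CompactSpace G] [T2Space G] [MeasurableSpace G] [BorelSpace G]
  {m : Measure G} [m.IsHaarMeasure] [m.Regular] {f : G → ℂ}
  {μ : ComplexMeasure G} [μ.variation.Regular] {Φ : YoungFunction}

/-- By Jensen's inequality for `|μ|` normalized to mass one, `Φ(|μ * f| / (k |μ|(G)))` is at most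
the average of the translates of `Φ(|f| / k)`; integrating over `t` leaves the modular of `f / k`.
-/
theorem mem_luxSet_conv (hfin : ∀ x : ℝ≥0, Φ x ≠ ⊤) (hμ : μ Set.univ ≠ 0)
    (hf : AEStronglyMeasurable f m) {k : ℝ≥0} (hk : k ∈ luxSet Φ m f) :
    k * (μ.variation Set.univ).toNNReal ∈ luxSet Φ m (conv μ f) := by
  set l := μ.variation with hl
  set Λ : ℝ≥0 := (l Set.univ).toNNReal with hΛ
  have hΛl : (Λ : ℝ≥0∞) = l Set.univ := ENNReal.coe_toNNReal (measure_ne_top _ _)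
  have hl0 : l Set.univ ≠ 0 := by
    intro h0
    have := VectorMeasure.enorm_measure_le_variation μ Set.univ
    rw [← hl, h0, le_zero_iff, enorm_eq_zero] at this
    exact hμ this
  have : NeZero l := ⟨by simpa using hl0⟩
  have hΛ0 : 0 < Λ := by
    rw [← ENNReal.coe_pos, hΛl]
    exact pos_iff_ne_zero.2 hl0
  have hk0 : 0 < k := hk.1
  refine ⟨mul_pos hk0 hΛ0, ?_⟩
  have hfi : Integrable f m := integrable_of_eLux_lt_top hf (eLux_lt_top_iff.2 ⟨k, hk⟩)
  -- The modular density, made complex valued so that the results on translates apply to it.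
  let g : G → ℂ := fun x => ((Φ (‖f x‖₊ / k)).toReal : ℂ)
  have hge : ∀ x, ‖g x‖ₑ = Φ (‖f x‖₊ / k) := fun x => by
    rw [← ofReal_norm, Complex.norm_of_nonneg ENNReal.toReal_nonneg, ENNReal.ofReal_toReal (hfin _)]
  have hgi : Integrable g m := by
    refine ⟨(Complex.measurable_ofReal.comp_aemeasurable
      (aemeasurable_young hf k).ennreal_toReal).aestronglyMeasurable, ?_⟩
    simp only [HasFiniteIntegral, hge]
    exact hk.2.trans_lt ENNReal.one_lt_top
  have hpt : ∀ᵐ t ∂m, Φ (‖conv μ f t‖₊ / (k * Λ))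
      ≤ (l Set.univ)⁻¹ * ∫⁻ s, ‖g (s⁻¹ * t)‖ₑ ∂l := by
    filter_upwards [ae_integrable_translates (l := l) hfi, ae_integrable_translates (l := l) hgi]
      with t h1 h2
    have h3 : Integrable (fun s => ((‖f (s⁻¹ * t)‖₊ / k : ℝ≥0) : ℝ)) l := by
      simpa using h1.norm.div_const (k : ℝ)
    have h4 := YoungFunction.map_average_le hfin h3 (by
      simp_rw [← hge]
      exact h2.2.ne)
    simp_rw [hge]
    refine le_trans (Φ.mono ?_) h4
    rw [← NNReal.coe_le_coe, Real.coe_toNNReal _ (by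
      rw [average_eq]
      exact smul_nonneg (by positivity) (integral_nonneg fun s => NNReal.coe_nonneg _)),
      average_eq, smul_eq_mul]
    have h5 : ∫ s, ((‖f (s⁻¹ * t)‖₊ / k : ℝ≥0) : ℝ) ∂l = (∫ s, ‖f (s⁻¹ * t)‖ ∂l) / k := by
      simp_rw [NNReal.coe_div, coe_nnnorm]
      exact integral_div _ _
    rw [h5]
    have h6 : l.real Set.univ = Λ := rfl
    rw [h6, NNReal.coe_div, NNReal.coe_mul, coe_nnnorm]
    have hk' : (0 : ℝ) < k := hk0
    have hΛ' : (0 : ℝ) < Λ := hΛ0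
    calc ‖conv μ f t‖ / (k * Λ) ≤ (∫ s, ‖f (s⁻¹ * t)‖ ∂l) / (k * Λ) := by
          gcongr
          exact norm_conv_le μ f t
      _ = _ := by field_simp
  calc ∫⁻ t, Φ (‖conv μ f t‖₊ / (k * Λ)) ∂m
      ≤ ∫⁻ t, (l Set.univ)⁻¹ * ∫⁻ s, ‖g (s⁻¹ * t)‖ₑ ∂l ∂m := lintegral_mono_ae hpt
    _ = (l Set.univ)⁻¹ * ∫⁻ t, ∫⁻ s, ‖g (s⁻¹ * t)‖ₑ ∂l ∂m :=
        lintegral_const_mul' _ _ (ENNReal.inv_ne_top.2 hl0)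
    _ ≤ (l Set.univ)⁻¹ * (l Set.univ * ∫⁻ t, ‖g t‖ₑ ∂m) := by
        gcongr
        exact lintegral_lintegral_translates_le hgi
    _ ≤ 1 := by
        rw [← mul_assoc, ENNReal.inv_mul_cancel hl0 (measure_ne_top _ _), one_mul]
        simp_rw [hge]
        exact hk.2

/-- Young's inequality for the convolution of a measure and a function of an Orlicz space. -/
theorem eLux_conv_le (hfin : ∀ x : ℝ≥0, Φ x ≠ ⊤) (hμ : μ Set.univ ≠ 0)
    (hf : AEStronglyMeasurable f m) (hf' : eLux Φ m f < ⊤) :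
    eLux Φ m (conv μ f) ≤ μ.variation Set.univ * eLux Φ m f := by
  refine ENNReal.le_of_forall_pos_le_add fun ε hε _ => ?_
  set Λ : ℝ≥0 := (μ.variation Set.univ).toNNReal with hΛ
  have hΛl : (Λ : ℝ≥0∞) = μ.variation Set.univ := ENNReal.coe_toNNReal (measure_ne_top _ _)
  -- Dividing by `Λ + 1` rather than `Λ` needs no positivity and still leaves an error of at most
  -- `ε` after multiplication by `Λ`.
  have hδ : ((ε / (Λ + 1) : ℝ≥0) : ℝ≥0∞) ≠ 0 := by
    simp [hε.ne']
  obtain ⟨k, hk, hkε⟩ := exists_mem_luxSet_of_eLux_lt (ENNReal.lt_add_right hf'.ne hδ)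
  refine (eLux_le (mem_luxSet_conv hfin hμ hf hk)).trans ?_
  rw [ENNReal.coe_mul, mul_comm, hΛl]
  refine (mul_le_mul_right hkε.le _).trans ?_
  rw [mul_add]
  gcongr
  rw [← hΛl, ← ENNReal.coe_mul, ENNReal.coe_le_coe, mul_div_assoc', div_le_iff₀ (by positivity),
    mul_comm ε]
  gcongr
  exact le_self_add

variable (Φ m μ) in
/-- The operator `f ↦ μ * f` on the Orlicz space. -/
def convOp (hfin : ∀ x : ℝ≥0, Φ x ≠ ⊤)
    (hμ : μ Set.univ ≠ 0) : OrliczSpace Φ m →L[ℂ] OrliczSpace Φ m :=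
  have hi : ∀ u : OrliczSpace Φ m, Integrable (u : G →ₘ[m] ℂ) m := fun u =>
    integrable_of_eLux_lt_top (u : G →ₘ[m] ℂ).aestronglyMeasurable (eLux_coe_lt_top u)
  have hle : ∀ u : OrliczSpace Φ m, eLux Φ m (conv μ (u : G →ₘ[m] ℂ))
      ≤ μ.variation Set.univ * ‖u‖ₑ := fun u => by
    rw [enorm_eq_eLux]
    exact eLux_conv_le hfin hμ (u : G →ₘ[m] ℂ).aestronglyMeasurable (eLux_coe_lt_top u)
  have hlt : ∀ u : OrliczSpace Φ m, eLux Φ m (conv μ (u : G →ₘ[m] ℂ)) < ⊤ := fun u =>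
    (hle u).trans_lt (ENNReal.mul_lt_top (measure_lt_top _ _) enorm_lt_top)
  LinearMap.mkContinuous
    { toFun := fun u => ofFun Φ m (conv μ (u : G →ₘ[m] ℂ))
      map_add' := fun u v => by
        rw [← ofFun_add (aestronglyMeasurable_conv (hi u)) (hlt u)
          (aestronglyMeasurable_conv (hi v)) (hlt v)]
        exact ofFun_congr ((conv_congr (coe_add_ae u v)).trans (conv_add (hi u) (hi v)))
      map_smul' := fun c u => by
        rw [RingHom.id_apply, ← ofFun_smul c (aestronglyMeasurable_conv (hi u)) (hlt u),
          ← conv_const_smul]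
        exact ofFun_congr (conv_congr (coe_smul_ae c u)) }
    (μ.variation Set.univ).toReal fun u => by
      change ‖ofFun Φ m (conv μ (u : G →ₘ[m] ℂ))‖ ≤ _
      rw [← toReal_enorm, ← toReal_enorm, ← ENNReal.toReal_mul,
        enorm_ofFun (aestronglyMeasurable_conv (hi u)) (hlt u)]
      exact ENNReal.toReal_mono (ENNReal.mul_ne_top (measure_ne_top _ _) enorm_ne_top) (hle u)

theorem coe_convOp (hfin : ∀ x : ℝ≥0, Φ x ≠ ⊤) (hμ : μ Set.univ ≠ 0) (u : OrliczSpace Φ m) :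
    ((convOp m μ Φ hfin hμ u : OrliczSpace Φ m) : G →ₘ[m] ℂ) =ᵐ[m]
      conv μ (u : G →ₘ[m] ℂ) :=
  coe_ofFun (aestronglyMeasurable_conv (integrable_of_eLux_lt_top
    (u : G →ₘ[m] ℂ).aestronglyMeasurable (eLux_coe_lt_top u)))
    ((eLux_conv_le hfin hμ (u : G →ₘ[m] ℂ).aestronglyMeasurable (eLux_coe_lt_top u)).trans_lt
      (ENNReal.mul_lt_top (measure_lt_top _ _) (eLux_coe_lt_top u)))

end ConvolutionOperator

/-! ### The gliding hump: from uniform smallness in `L¹` to the Luxemburg norm. -/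

section UniformAdditivity

variable {α : Type*} [MeasurableSpace α] {Φ : YoungFunction} {m : Measure α}

theorem measure_norm_ge_le {f : α → ℂ} (hf : AEStronglyMeasurable f m) {η : ℝ≥0} (hη : 0 < η)
    {c : ℝ≥0∞} (hc : ∫⁻ x, ‖f x‖ₑ ∂m ≤ c) : m {x | η ≤ ‖f x‖₊} ≤ c / η := by
  have hη' : (η : ℝ≥0∞) ≠ 0 := by exact_mod_cast hη.ne'
  have h := meas_ge_le_lintegral_div hf.enorm hη' ENNReal.coe_ne_top
  have e : {x | η ≤ ‖f x‖₊} = {x | (η : ℝ≥0∞) ≤ ‖f x‖ₑ} := by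
    ext x
    exact ENNReal.coe_le_coe.symm
  rw [e]
  exact h.trans (ENNReal.div_le_div_right hc _)

theorem nullMeasurableSet_norm_ge {f : α → ℂ} (hf : AEStronglyMeasurable f m) (η : ℝ≥0) :
    NullMeasurableSet {x | η ≤ ‖f x‖₊} m :=
  nullMeasurableSet_le aemeasurable_const hf.aemeasurable.nnnorm

/-- The estimate behind the gliding hump: if `S = u + a + w` where `u` and `S` are small on small
sets and `w` is tiny in measure compared with `a`, then `a` is small in the Luxemburg gauge. -/
theorem eLux_le_of_hump {S u a w : α → ℂ} (hSm : AEStronglyMeasurable S m)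
    (hum : AEStronglyMeasurable u m) (ham : AEStronglyMeasurable a m)
    (hwm : AEStronglyMeasurable w m) (hS : S =ᵐ[m] u + a + w) {d : ℝ≥0∞} {η : ℝ≥0}
    (hη : ∀ f : α → ℂ, (∀ᵐ x ∂m, ‖f x‖₊ ≤ η) → eLux Φ m f ≤ d) {r r' : ℝ≥0∞}
    (har : m {x | η ≤ ‖a x‖₊} ≤ r) (hwr : m {x | η ≤ ‖w x‖₊} ≤ r')
    (hSr : ∀ E, NullMeasurableSet E m → m E ≤ r → eLux Φ m (E.indicator S) ≤ d)
    (hur : ∀ E, NullMeasurableSet E m → m E ≤ r → eLux Φ m (E.indicator u) ≤ d)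
    (har' : ∀ E, NullMeasurableSet E m → m E ≤ r' → eLux Φ m (E.indicator a) ≤ d) :
    eLux Φ m a ≤ 5 * d := by
  set E₁ : Set α := {x | η ≤ ‖a x‖₊} with hE₁
  set E₂ : Set α := {x | η ≤ ‖w x‖₊} with hE₂
  have h₁ : NullMeasurableSet E₁ m := nullMeasurableSet_norm_ge ham η
  have h₂ : NullMeasurableSet E₂ m := nullMeasurableSet_norm_ge hwm η
  have hF : NullMeasurableSet (E₁ \ E₂) m := h₁.diff h₂
  have hmF : m (E₁ \ E₂) ≤ r := (measure_mono Set.sdiff_subset).trans har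
  -- Off `E₁` the hump is below `η`; on `E₁ ∩ E₂` its own absolute continuity applies; on `E₁ \ E₂`
  -- it equals `S - u - w`, with `S` and `u` small there and `w` below `η`. The five terms give the
  -- factor `5`.
  have hsplit : a =ᵐ[m] E₁ᶜ.indicator a + ((E₁ ∩ E₂).indicator a
      + ((E₁ \ E₂).indicator S + ((E₁ \ E₂).indicator (-u) + (E₁ \ E₂).indicator (-w)))) := by
    filter_upwards [hS] with x hx
    by_cases hx1 : x ∈ E₁ <;> by_cases hx2 : x ∈ E₂ <;> simp [hx1, hx2, hx]
    ring
  have hneg : ∀ f : α → ℂ, eLux Φ m ((E₁ \ E₂).indicator (-f)) ≤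
      eLux Φ m ((E₁ \ E₂).indicator f) := fun f => eLux_mono (ae_of_all _ fun x => by
    by_cases hx : x ∈ E₁ \ E₂ <;> simp [hx])
  have b1 : eLux Φ m (E₁ᶜ.indicator a) ≤ d := hη _ (ae_of_all _ fun x => by
    by_cases hx : x ∈ E₁
    · simp [hx]
    · have : ‖a x‖₊ < η := not_le.1 hx
      simpa [hx] using this.le)
  have b5 : eLux Φ m ((E₁ \ E₂).indicator (-w)) ≤ d := hη _ (ae_of_all _ fun x => by
    by_cases hx : x ∈ E₂
    · simp [hx]
    · have : ‖w x‖₊ < η := not_le.1 hx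
      by_cases hx1 : x ∈ E₁
      · simpa [hx, hx1] using this.le
      · simp [hx1])
  have b2 : eLux Φ m ((E₁ ∩ E₂).indicator a) ≤ d :=
    har' _ (h₁.inter h₂) ((measure_mono Set.inter_subset_right).trans hwr)
  have b3 : eLux Φ m ((E₁ \ E₂).indicator S) ≤ d := hSr _ hF hmF
  have b4 : eLux Φ m ((E₁ \ E₂).indicator (-u)) ≤ d := (hneg u).trans (hur _ hF hmF)
  have m1 := ham.indicator₀ h₁.compl
  have m2 := ham.indicator₀ (h₁.inter h₂)
  have m3 := hSm.indicator₀ hF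
  have m4 := hum.neg.indicator₀ hF
  rw [eLux_congr hsplit]
  calc _ ≤ d + (d + (d + (d + d))) :=
        (eLux_add_le m1).trans (add_le_add b1 ((eLux_add_le m2).trans (add_le_add b2
          ((eLux_add_le m3).trans (add_le_add b3 ((eLux_add_le m4).trans (add_le_add b4 b5)))))))
    _ = 5 * d := by ring

variable [IsProbabilityMeasure m] {Y : Set α → α → ℂ} {D : ℕ → Set α} {c : ℕ → ℝ≥0∞}

/-- A finitely additive family of functions of an Orlicz space which is countably additive in `L¹`
is uniformly small in the Luxemburg gauge along decreasing sets. -/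
theorem exists_forall_eLux_le (hfin : ∀ x : ℝ≥0, Φ x ≠ ⊤) (hΦ : DeltaTwo Φ)
    (hD : ∀ n, MeasurableSet (D n)) (hDa : Antitone D)
    (hYm : ∀ A, MeasurableSet A → AEStronglyMeasurable (Y A) m)
    (hYf : ∀ A, MeasurableSet A → eLux Φ m (Y A) < ⊤)
    (hYadd : ∀ A B, MeasurableSet A → MeasurableSet B → Disjoint A B →
      Y (A ∪ B) =ᵐ[m] Y A + Y B)
    (hYc : ∀ n A, MeasurableSet A → A ⊆ D n → ∫⁻ x, ‖Y A x‖ₑ ∂m ≤ c n)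
    (hc : Tendsto c atTop (𝓝 0)) {ε : ℝ≥0} (hε : 0 < ε) :
    ∃ n, ∀ A, MeasurableSet A → A ⊆ D n → eLux Φ m (Y A) ≤ ε := by
  by_contra! hcon
  set d : ℝ≥0 := ε / 5 with hd
  have hd0 : 0 < d := by positivity
  obtain ⟨η, hη0, hη⟩ := eLux_le_of_norm_le (Φ := Φ) (m := m) hfin hd0
  have hη' : (η : ℝ≥0∞) ≠ 0 := by exact_mod_cast hη0.ne'
  have hcη : Tendsto (fun n => c n / η) atTop (𝓝 0) := by
    simpa using ENNReal.Tendsto.div_const hc (Or.inr hη')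
  have hcη2 : Tendsto (fun n => (c n + c n) / η) atTop (𝓝 0) := by
    simpa using ENNReal.Tendsto.div_const (hc.add hc) (Or.inr hη')
  -- The index `k` is chosen after `U`, so that `Y U` is negligible where the new hump `Y A` is
  -- large; `k'` is chosen after `A`, so that `Y A` is negligible where later corrections are large.
  -- The bound by `1 / (j + 1)` prepares for the final union, whose absolute continuity is known
  -- only after the construction.
  have step : ∀ (U : Set α) (N j : ℕ), ∃ k, ∃ A : Set α, ∃ k', MeasurableSet U →
      N ≤ k ∧ k ≤ k' ∧ MeasurableSet A ∧ A ⊆ D k ∧ ε < eLux Φ m (Y A) ∧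
      (∀ E, NullMeasurableSet E m → m E ≤ c k / η → eLux Φ m (E.indicator (Y U)) ≤ d) ∧
      c k / η < ((j : ℝ≥0∞) + 1)⁻¹ ∧
      (∀ E, NullMeasurableSet E m → m E ≤ (c k' + c k') / η →
        eLux Φ m (E.indicator (Y A)) ≤ d) := by
    intro U N j
    by_cases hU : MeasurableSet U
    · obtain ⟨δ, hδ0, hδ⟩ := exists_eLux_indicator_le hfin hΦ (hYf U hU) hd0
      have hj : (0 : ℝ≥0∞) < ((j : ℝ≥0∞) + 1)⁻¹ :=
        ENNReal.inv_pos.2 (by finiteness)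
      obtain ⟨k, ⟨hk1, hk2⟩, hkN⟩ := (((hcη.eventually (gt_mem_nhds hδ0)).and
        (hcη.eventually (gt_mem_nhds hj))).and (eventually_ge_atTop N)).exists
      obtain ⟨A, hA, hAD, hAε⟩ := hcon k
      obtain ⟨δ', hδ0', hδ'⟩ := exists_eLux_indicator_le hfin hΦ (hYf A hA) hd0
      obtain ⟨k', hk', hkk'⟩ := ((hcη2.eventually (gt_mem_nhds hδ0')).and
        (eventually_ge_atTop k)).exists
      exact ⟨k, A, k', fun _ => ⟨hkN, hkk', hA, hAD, hAε,
        fun E hE hmE => hδ E hE (hmE.trans_lt hk1), hk2,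
        fun E hE hmE => hδ' E hE (hmE.trans_lt hk')⟩⟩
    · exact ⟨0, ∅, 0, fun h => absurd h hU⟩
  choose k A k' hstep using step
  -- Only the part of a hump outside `D (k' ..)` is added; the union so far then stays disjoint from
  -- the set containing all later humps.
  let seq : ℕ → Set α × ℕ := fun n => Nat.rec (∅, 0)
    (fun j p => (p.1 ∪ (A p.1 p.2 j \ D (k' p.1 p.2 j)), k' p.1 p.2 j)) n
  let U : ℕ → Set α := fun j => (seq j).1
  let N : ℕ → ℕ := fun j => (seq j).2
  let B : ℕ → Set α := fun j => A (U j) (N j) j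
  have hU0 : U 0 = ∅ := rfl
  have hUs : ∀ j, U (j + 1) = U j ∪ (B j \ D (N (j + 1))) := fun j => rfl
  have hN : ∀ j, N (j + 1) = k' (U j) (N j) j := fun j => rfl
  have hUm : ∀ j, MeasurableSet (U j) := by
    intro j
    induction j with
    | zero => rw [hU0]; exact MeasurableSet.empty
    | succ j ih =>
      rw [hUs]
      exact ih.union ((hstep (U j) (N j) j ih).2.2.1.diff (hD _))
  have hs := fun j => hstep (U j) (N j) j (hUm j)
  have hNmono : Monotone N := monotone_nat_of_le_succ fun j => by
    rw [hN]
    exact (hs j).1.trans (hs j).2.1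
  have hBN : ∀ j, B j ⊆ D (N j) := fun j => (hs j).2.2.2.1.trans (hDa (hs j).1)
  have hUD : ∀ j, Disjoint (U j) (D (N j)) := by
    intro j
    induction j with
    | zero => rw [hU0]; exact disjoint_bot_left
    | succ j ih =>
      rw [hUs]
      exact Disjoint.union_left (ih.mono_right (hDa (hNmono j.le_succ))) Set.disjoint_sdiff_left
  have hUmono : Monotone U := monotone_nat_of_le_succ fun j => by
    rw [hUs]
    exact Set.subset_union_left
  set W : Set α := ⋃ j, U j with hW
  have hWm : MeasurableSet W := MeasurableSet.iUnion hUm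
  have hWD : ∀ j, W \ U j ⊆ D (N j) := by
    intro j x hx
    obtain ⟨i, hi⟩ := Set.mem_iUnion.1 hx.1
    have key : ∀ i, x ∈ U i → x ∈ D (N j) := by
      intro i
      induction i with
      | zero => intro h; rw [hU0] at h; exact h.elim
      | succ i ih =>
        intro h
        rw [hUs] at h
        rcases h with h | h
        · exact ih h
        · rcases le_or_gt j i with hji | hij
          · exact hDa (hNmono hji) (hBN i h.1)
          · exact absurd (hUmono hij (by rw [Nat.succ_eq_add_one, hUs]; exact Or.inr h)) hx.2
    exact key i hi
  -- The threshold for `Y W` selects the stage `j` at which the contradiction occurs.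
  obtain ⟨τ, hτ0, hτ⟩ := exists_eLux_indicator_le hfin hΦ (hYf W hWm) hd0
  obtain ⟨j, hj⟩ : ∃ j : ℕ, ((j : ℝ≥0∞) + 1)⁻¹ < τ := by
    obtain ⟨n, hn⟩ := ENNReal.exists_inv_nat_lt hτ0.ne'
    exact ⟨n, (ENNReal.inv_le_inv.2 le_self_add).trans_lt hn⟩
  obtain ⟨-, hkk', hBm, hBD, hBε, hu, hkj, ha⟩ := hs j
  rw [← hN] at ha hkk'
  set p := N (j + 1) with hp
  have hBU : Disjoint (U j) (B j) := (hUD j).mono_right (hBN j)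
  have hVm : MeasurableSet (W \ U (j + 1)) := hWm.diff (hUm (j + 1))
  have hIm : MeasurableSet (B j ∩ D p) := hBm.inter (hD p)
  have e1 : Y W =ᵐ[m] Y (U (j + 1)) + Y (W \ U (j + 1)) := by
    have := hYadd (U (j + 1)) (W \ U (j + 1)) (hUm (j + 1)) hVm Set.disjoint_sdiff_right
    rwa [Set.union_sdiff_cancel (Set.subset_iUnion U (j + 1))] at this
  have e2 : Y (U (j + 1)) =ᵐ[m] Y (U j) + Y (B j \ D p) :=
    hYadd (U j) (B j \ D p) (hUm j) (hBm.diff (hD p)) (hBU.mono_right Set.sdiff_subset)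
  have e3 : Y (B j) =ᵐ[m] Y (B j ∩ D p) + Y (B j \ D p) := by
    have := hYadd (B j ∩ D p) (B j \ D p) hIm (hBm.diff (hD p))
      (Set.disjoint_sdiff_right.mono_left Set.inter_subset_right)
    rwa [Set.inter_union_sdiff] at this
  -- The later humps minus the discarded part of the present one; both sets lie in `D p`, which
  -- makes `w` small in `L¹`.
  set w : α → ℂ := Y (W \ U (j + 1)) - Y (B j ∩ D p) with hw
  have hS : Y W =ᵐ[m] Y (U j) + Y (B j) + w := by
    filter_upwards [e1, e2, e3] with x h1 h2 h3
    simp only [hw, Pi.add_apply, Pi.sub_apply] at h1 h2 h3 ⊢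
    rw [h1, h2, h3]
    ring
  have hwc : ∫⁻ x, ‖w x‖ₑ ∂m ≤ c p + c p := by
    calc ∫⁻ x, ‖w x‖ₑ ∂m ≤ ∫⁻ x, (‖Y (W \ U (j + 1)) x‖ₑ + ‖Y (B j ∩ D p) x‖ₑ) ∂m :=
          lintegral_mono fun x => enorm_sub_le
      _ = ∫⁻ x, ‖Y (W \ U (j + 1)) x‖ₑ ∂m + ∫⁻ x, ‖Y (B j ∩ D p) x‖ₑ ∂m :=
          lintegral_add_left' (hYm _ hVm).enorm _
      _ ≤ c p + c p := add_le_add (hYc p _ hVm (hWD (j + 1)))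
          (hYc p _ hIm Set.inter_subset_right)
  have hwm : AEStronglyMeasurable w m := (hYm _ hVm).sub (hYm _ hIm)
  have hfinal := eLux_le_of_hump (hYm W hWm) (hYm _ (hUm j)) (hYm _ hBm) hwm hS hη
    (measure_norm_ge_le (hYm _ hBm) hη0 (hYc _ _ hBm hBD)) (measure_norm_ge_le hwm hη0 hwc)
    (fun E hE hmE => hτ E hE (hmE.trans_lt (hkj.trans hj))) hu ha
  refine absurd hfinal (not_le.2 (lt_of_le_of_lt (le_of_eq ?_) hBε))
  rw [hd, ← ENNReal.coe_ofNat, ← ENNReal.coe_mul, mul_div_cancel₀ _ (by norm_num)]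

end UniformAdditivity

/-! ### Set integrals as test functionals, and truncation. -/

section SetIntegral

variable {α : Type*} [MeasurableSpace α]

variable (Φ : YoungFunction) (m : Measure α) [IsFiniteMeasure m] in
/-- Integration over a set, as a functional on the Orlicz space of a finite measure. -/
def setIntegralDual (B : Set α) : StrongDual ℂ (OrliczSpace Φ m) :=
  have hi : ∀ u : OrliczSpace Φ m, Integrable (u : α →ₘ[m] ℂ) (m.restrict B) := fun u =>
    (integrable_of_eLux_lt_top (u : α →ₘ[m] ℂ).aestronglyMeasurable (eLux_coe_lt_top u)).restrict
  LinearMap.mkContinuous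
    { toFun := fun u => ∫ x in B, (u : α →ₘ[m] ℂ) x ∂m
      map_add' := fun u v => by
        rw [← integral_add (hi u) (hi v)]
        exact integral_congr_ae (ae_restrict_of_ae (coe_add_ae u v))
      map_smul' := fun c u => by
        rw [RingHom.id_apply, smul_eq_mul, ← integral_const_mul]
        exact integral_congr_ae (ae_restrict_of_ae (coe_smul_ae c u)) }
    (exists_lintegral_le_mul_eLux Φ m).choose fun u => by
      change ‖∫ x in B, (u : α →ₘ[m] ℂ) x ∂m‖ ≤ _
      rw [← toReal_enorm, ← toReal_enorm, ← ENNReal.coe_toReal, ← ENNReal.toReal_mul]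
      refine ENNReal.toReal_mono (ENNReal.mul_ne_top ENNReal.coe_ne_top enorm_ne_top) ?_
      rw [enorm_eq_eLux]
      exact (enorm_integral_le_lintegral_enorm _).trans ((setLIntegral_le_lintegral _ _).trans
        ((exists_lintegral_le_mul_eLux Φ m).choose_spec _))

variable {Φ : YoungFunction} {m : Measure α} {f : α → ℂ}

theorem setIntegralDual_apply [IsFiniteMeasure m] (B : Set α) (u : OrliczSpace Φ m) :
    setIntegralDual Φ m B u = ∫ x in B, (u : α →ₘ[m] ℂ) x ∂m := rfl

theorem tendsto_lintegral_indicator_norm_gt (hf : StronglyMeasurable f) (hfi : Integrable f m) :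
    Tendsto (fun n : ℕ => ∫⁻ x, ‖{x | (n : ℝ) < ‖f x‖}.indicator f x‖ₑ ∂m) atTop (𝓝 0) := by
  have hD : ∀ n : ℕ, MeasurableSet {x | (n : ℝ) < ‖f x‖} := fun n =>
    measurableSet_lt measurable_const hf.measurable.norm
  have h := tendsto_lintegral_of_dominated_convergence (μ := m)
    (F := fun (n : ℕ) x => ‖{x | (n : ℝ) < ‖f x‖}.indicator f x‖ₑ) (f := fun _ => 0)
    (fun x => ‖f x‖ₑ) (fun n => (hf.measurable.indicator (hD n)).enorm)
    (fun n => ae_of_all _ fun x => enorm_indicator_le_enorm_self _ _) hfi.2.ne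
    (ae_of_all _ fun x => by
      obtain ⟨N, hN⟩ := exists_nat_ge ‖f x‖
      refine tendsto_const_nhds.congr' ?_
      filter_upwards [eventually_ge_atTop N] with n hn
      have : x ∉ {x | (n : ℝ) < ‖f x‖} := not_lt.2 (hN.trans (by exact_mod_cast hn))
      rw [Set.indicator_of_notMem this, enorm_zero])
  simpa using h

theorem eLux_compl_indicator_norm_gt_lt_top [IsProbabilityMeasure m] (hfin : ∀ x : ℝ≥0, Φ x ≠ ⊤)
    (f : α → ℂ) (n : ℕ) : eLux Φ m ({x | (n : ℝ) < ‖f x‖}ᶜ.indicator f) < ⊤ :=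
  eLux_lt_top_of_norm_le (c := n) hfin (ae_of_all _ fun x => by
    by_cases hx : (n : ℝ) < ‖f x‖
    · have : x ∉ {x | (n : ℝ) < ‖f x‖}ᶜ := fun h => h hx
      rw [Set.indicator_of_notMem this, nnnorm_zero]
      exact zero_le
    · rw [Set.indicator_of_mem (show x ∈ {x | (n : ℝ) < ‖f x‖}ᶜ from hx), ← NNReal.coe_le_coe]
      exact not_lt.1 hx)

end SetIntegral

/-! ### Independence of the chosen representative. -/

section Congruence

variable {α : Type*} [MeasurableSpace α] {X : Type*} [NormedAddCommGroup X] [NormedSpace ℂ X]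
  {ν : VectorMeasure α X} {f g : α → ℂ}

theorem HasVectorIntegral.congr (h : ∀ x', f =ᵐ[(pairing ν x').variation] g) {A : Set α}
    (hA : MeasurableSet A) {x : X} (hx : HasVectorIntegral ν f A x) :
    HasVectorIntegral ν g A x := fun x' => by
  rw [← hx x', ← cintegral_indicator hA, ← cintegral_indicator hA]
  refine cintegral_congr ?_
  filter_upwards [h x'] with t ht
  simp only [Set.indicator, ht]

theorem MemL1.congr (h : ∀ x', f =ᵐ[(pairing ν x').variation] g) (hf : MemL1 ν f) :
    MemL1 ν g :=
  memL1_of_forall_exists (fun x' => (hf.1 x').congr (h x')) fun A hA =>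
    let ⟨x, hx, _⟩ := hf.2 A hA
    ⟨x, hx.congr h hA⟩

theorem integrationOp_congr (h : ∀ x', f =ᵐ[(pairing ν x').variation] g) (hf : MemL1 ν f) :
    integrationOp ν f = integrationOp ν g :=
  (integrationOp_eq (hf.congr h)
    ((hasVectorIntegral_integrationOp hf).congr h MeasurableSet.univ)).symm

theorem vnorm_congr (h : ∀ x', f =ᵐ[(pairing ν x').variation] g) : vnorm ν f = vnorm ν g :=
  iSup_congr fun x' => iSup_congr fun _ =>
    lintegral_congr_ae ((h x').mono fun _ ht => congrArg enorm ht)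

end Congruence

/-! ### The optimal domain of the convolution operator. -/

section ConvolutionMeasure

variable {G : Type*} [Group G] [TopologicalSpace G] [IsTopologicalGroup G]
  [CompactSpace G] [T2Space G] [MeasurableSpace G] [BorelSpace G]
  {m : Measure G} [m.IsHaarMeasure] [m.Regular] [IsProbabilityMeasure m]
  {Φ : YoungFunction} {hfin : ∀ x : ℝ≥0, Φ x ≠ ⊤} {hΦ : DeltaTwo Φ}
  {μ : ComplexMeasure G} [μ.variation.Regular] {hμ : μ Set.univ ≠ 0} {f : G → ℂ}

local notation "ν" => operatorMeasure hfin hΦ (convOp m μ Φ hfin hμ)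

omit [IsProbabilityMeasure m] in
theorem coe_convOp_ofFun (hf : AEStronglyMeasurable f m) (hf' : eLux Φ m f < ⊤) :
    ((convOp m μ Φ hfin hμ (ofFun Φ m f) : OrliczSpace Φ m) : G →ₘ[m] ℂ) =ᵐ[m] conv μ f :=
  (coe_convOp hfin hμ _).trans (conv_congr (coe_ofFun hf hf'))

theorem pairing_setIntegralDual_univ {A : Set G} (hA : MeasurableSet A) :
    pairing ν (setIntegralDual Φ m Set.univ) A = μ Set.univ * (m A).toReal := by
  have hm := aestronglyMeasurable_indicator_one (m := m) hA
  have hl := eLux_indicator_one_lt_top (Φ := Φ) (m := m) hfin A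
  rw [pairing_apply, operatorMeasure_apply hA, setIntegralDual_apply, Measure.restrict_univ,
    integral_congr_ae (coe_convOp_ofFun hm hl), integral_conv (integrable_of_eLux_lt_top hm hl)]
  congr 1
  have h := integral_indicator_const (μ := m) (1 : ℂ) hA
  rw [← Pi.one_def] at h
  rw [h, measureReal_def]
  simp

theorem smul_le_variation_pairing :
    ‖μ Set.univ‖ₑ • m ≤ (pairing ν (setIntegralDual Φ m Set.univ)).variation := by
  refine Measure.le_iff.2 fun A hA => ?_
  refine le_trans (le_of_eq ?_) (VectorMeasure.enorm_measure_le_variation _ A)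
  rw [pairing_setIntegralDual_univ hA, enorm_mul, Measure.smul_apply, smul_eq_mul]
  congr 1
  rw [← ofReal_norm, Complex.norm_real, Real.norm_of_nonneg ENNReal.toReal_nonneg,
    ENNReal.ofReal_toReal (measure_ne_top _ _)]

/-- The vector measure of a convolution operator has the same null sets as the Haar measure. -/
theorem isNull_convOp_iff {A : Set G} (hA : MeasurableSet A) : IsNull ν A ↔ m A = 0 := by
  refine ⟨fun h => ?_, fun h B _ hBA => operatorMeasure_null (measure_mono_null hBA h)⟩
  have h1 := pairing_setIntegralDual_univ (hfin := hfin) (hΦ := hΦ) (hμ := hμ) (m := m) hA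
  rw [pairing_apply, h A hA subset_rfl, map_zero, eq_comm, mul_eq_zero, Complex.ofReal_eq_zero,
    ENNReal.toReal_eq_zero_iff] at h1
  exact (h1.resolve_left hμ).resolve_right (measure_ne_top _ _)

/-- Weak integrability against the single functional `u ↦ ∫ u dm` suffices, since its scalar measure
has variation at least `|μ(G)| m`. -/
theorem integrable_of_memL1 (hf : MemL1 ν f) : Integrable f m := by
  have h := (hf.1 (setIntegralDual Φ m Set.univ)).mono_measure smul_le_variation_pairing
  exact (integrable_smul_measure (by simpa using hμ) enorm_ne_top).1 h

theorem ae_pairing {g : G → ℂ} (h : f =ᵐ[m] g) (x' : StrongDual ℂ (OrliczSpace Φ m)) :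
    f =ᵐ[(pairing ν x').variation] g :=
  (pairing_operatorMeasure_absolutelyContinuous x').ae_eq h

/-- Both sides have the same integral over each `B`. The truncations of `f` are bounded, hence in
`L^Φ`, where the claim is known; the left side passes to the limit by dominated convergence for the
scalar measure, the right side by `L¹`-continuity of convolution. -/
theorem coe_integrationOp_of_stronglyMeasurable (hf : MemL1 ν f) (hfm : StronglyMeasurable f) :
    ((integrationOp ν f : OrliczSpace Φ m) : G →ₘ[m] ℂ) =ᵐ[m] conv μ f := by
  have hfi : Integrable f m := integrable_of_memL1 hf
  set D : ℕ → Set G := fun n => {x | (n : ℝ) < ‖f x‖} with hDdef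
  have hD : ∀ n : ℕ, MeasurableSet (D n) := fun n =>
    measurableSet_lt measurable_const hfm.measurable.norm
  have hsm : ∀ n, StronglyMeasurable ((D n)ᶜ.indicator f) := fun n => hfm.indicator (hD n).compl
  have hlt : ∀ n, eLux Φ m ((D n)ᶜ.indicator f) < ⊤ :=
    eLux_compl_indicator_norm_gt_lt_top hfin f
  have hIi : Integrable ((integrationOp ν f : OrliczSpace Φ m) : G →ₘ[m] ℂ) m :=
    integrable_of_eLux_lt_top (AEEqFun.aestronglyMeasurable _) (eLux_coe_lt_top _)
  have hL1 : Tendsto (fun n => ∫⁻ x, ‖conv μ ((D n)ᶜ.indicator f) x - conv μ f x‖ₑ ∂m) atTop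
      (𝓝 0) := by
    have h0 := ENNReal.Tendsto.const_mul (a := μ.variation Set.univ)
      (tendsto_lintegral_indicator_norm_gt hfm hfi)
      (Or.inr (isFiniteMeasure_variation μ).measure_univ_lt_top.ne)
    rw [mul_zero] at h0
    refine tendsto_of_tendsto_of_tendsto_of_le_of_le tendsto_const_nhds h0 (fun _ => zero_le)
      fun n => ?_
    refine le_trans (le_of_eq (lintegral_congr_ae ?_)) (lintegral_conv_le (hfi.indicator (hD n)))
    rw [Set.indicator_compl]
    filter_upwards [conv_sub (μ := μ) hfi (hfi.indicator (hD n))] with x hx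
    rw [hx, Pi.sub_apply, sub_sub_cancel_left, enorm_neg]
  refine hIi.ae_eq_of_forall_setIntegral_eq _ _ (integrable_conv hfi) fun B _ _ => ?_
  have h1 := hasVectorIntegral_integrationOp hf (setIntegralDual Φ m B)
  rw [VectorMeasure.restrict_univ] at h1
  rw [← setIntegralDual_apply, ← h1]
  have hlim1 : Tendsto (fun n => cintegral (pairing ν (setIntegralDual Φ m B))
      ((D n)ᶜ.indicator f)) atTop (𝓝 (cintegral (pairing ν (setIntegralDual Φ m B)) f)) := by
    refine VectorMeasure.tendsto_integral_of_dominated_convergence (fun x => ‖f x‖)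
      (fun n => (hsm n).aestronglyMeasurable) (hf.1 _).norm
      (fun n => ae_of_all _ fun x => norm_indicator_le_norm_self _ _) (ae_of_all _ fun x => ?_)
    obtain ⟨N, hN⟩ := exists_nat_ge ‖f x‖
    refine tendsto_const_nhds.congr' ?_
    filter_upwards [eventually_ge_atTop N] with n hn
    have : x ∈ (D n)ᶜ := not_lt.2 (hN.trans (by exact_mod_cast hn))
    rw [Set.indicator_of_mem this]
  refine tendsto_nhds_unique hlim1 ?_
  have heq : ∀ n, cintegral (pairing ν (setIntegralDual Φ m B)) ((D n)ᶜ.indicator f)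
      = ∫ x in B, conv μ ((D n)ᶜ.indicator f) x ∂m := by
    intro n
    have h2 := hasVectorIntegral_operatorMeasure (hfin := hfin) (hΦ := hΦ)
      (T := convOp m μ Φ hfin hμ) (hsm n) (hlt n) MeasurableSet.univ (setIntegralDual Φ m B)
    rw [VectorMeasure.restrict_univ, Set.indicator_univ, setIntegralDual_apply] at h2
    rw [h2]
    exact integral_congr_ae (ae_restrict_of_ae
      (coe_convOp_ofFun (hsm n).aestronglyMeasurable (hlt n)))
  simp_rw [heq]
  exact tendsto_setIntegral_of_L1 _ (integrable_conv hfi).aestronglyMeasurable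
    (Eventually.of_forall fun n => integrable_conv (hfi.indicator (hD n).compl)) hL1 B

/-- The integration operator of the vector measure of a convolution operator is given by
convolution. -/
theorem coe_integrationOp (hf : MemL1 ν f) :
    ((integrationOp ν f : OrliczSpace Φ m) : G →ₘ[m] ℂ) =ᵐ[m] conv μ f := by
  have hfi : Integrable f m := integrable_of_memL1 hf
  have h := hfi.1.ae_eq_mk
  rw [integrationOp_congr (fun x' => ae_pairing h x') hf]
  exact (coe_integrationOp_of_stronglyMeasurable (hf.congr fun x' => ae_pairing h x')
    hfi.1.stronglyMeasurable_mk).trans (conv_congr h.symm)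

/-- The integrals of `f` over sets are the functions `μ * (f χ_A)`, bounded in `L¹(m)` by `|μ|(G)
∫_{|f|>n} |f| dm` for `A ⊆ {|f|>n}`. The gliding hump makes them uniformly small in norm, and
`vnorm_le_of_forall` costs the factor `4`. -/
theorem exists_vnorm_indicator_norm_gt_le (hf : MemL1 ν f) (hfm : StronglyMeasurable f) {ε : ℝ≥0}
    (hε : 0 < ε) : ∃ n : ℕ, vnorm ν ({x | (n : ℝ) < ‖f x‖}.indicator f) ≤ 4 * ε := by
  have hfi : Integrable f m := integrable_of_memL1 hf
  set D : ℕ → Set G := fun n => {x | (n : ℝ) < ‖f x‖} with hDdef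
  have hD : ∀ n : ℕ, MeasurableSet (D n) := fun n =>
    measurableSet_lt measurable_const hfm.measurable.norm
  have hDa : Antitone D := fun i j hij x hx =>
    lt_of_le_of_lt (by exact_mod_cast hij) (show (j : ℝ) < ‖f x‖ from hx)
  have hI : ∀ A, MeasurableSet A → ‖integrationOp ν (A.indicator f)‖ₑ
      = eLux Φ m (conv μ (A.indicator f)) := fun A hA => by
    rw [enorm_eq_eLux, eLux_congr (coe_integrationOp (hf.indicator hA))]
  have hc := ENNReal.Tendsto.const_mul (a := μ.variation Set.univ)
    (tendsto_lintegral_indicator_norm_gt hfm hfi)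
    (Or.inr (isFiniteMeasure_variation μ).measure_univ_lt_top.ne)
  rw [mul_zero] at hc
  obtain ⟨n, hn⟩ := exists_forall_eLux_le (Y := fun A => conv μ (A.indicator f)) hfin hΦ hD hDa
    (fun A hA => aestronglyMeasurable_conv (hfi.indicator hA))
    (fun A hA => by rw [← hI A hA]; exact enorm_lt_top)
    (fun A B hA hB hAB => by
      rw [Set.indicator_union_of_disjoint hAB]
      exact conv_add (hfi.indicator hA) (hfi.indicator hB))
    (fun n A hA hAD => (lintegral_conv_le (hfi.indicator hA)).trans
      (mul_le_mul_right (lintegral_mono fun x => by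
        by_cases hx : x ∈ A
        · rw [Set.indicator_of_mem hx, Set.indicator_of_mem (hAD hx)]
        · rw [Set.indicator_of_notMem hx, enorm_zero]
          exact zero_le) _)) hc hε
  refine ⟨n, vnorm_le_of_forall (hf.indicator (hD n)) fun A hA => ?_⟩
  rw [Set.indicator_indicator, hI _ (hA.inter (hD n))]
  exact hn _ (hA.inter (hD n)) Set.inter_subset_right

/-- The Orlicz space is dense in the optimal domain of the convolution operator. -/
theorem exists_vnorm_sub_lt (hf : MemL1 ν f) {ε : ℝ≥0∞} (hε : 0 < ε) :
    ∃ g : OrliczSpace Φ m, vnorm ν (f - (g : G →ₘ[m] ℂ)) < ε := by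
  have hfi : Integrable f m := integrable_of_memL1 hf
  have h := hfi.1.ae_eq_mk
  set f' := hfi.1.mk f with hf'
  have hfm : StronglyMeasurable f' := hfi.1.stronglyMeasurable_mk
  obtain ⟨η, hη0, hηε⟩ := ENNReal.lt_iff_exists_nnreal_btwn.1 hε
  have hη : 0 < η / 4 := by
    have : 0 < η := by exact_mod_cast hη0
    positivity
  obtain ⟨n, hn⟩ := exists_vnorm_indicator_norm_gt_le (hf.congr fun x' => ae_pairing h x') hfm hη
  have hD : MeasurableSet {x | (n : ℝ) < ‖f' x‖} :=
    measurableSet_lt measurable_const hfm.measurable.norm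
  -- The approximant is the truncation of `f'` at height `n`; bounded functions lie in `L^Φ` because
  -- `Φ` is finite and `m` is a probability measure.
  refine ⟨ofFun Φ m ({x | (n : ℝ) < ‖f' x‖}ᶜ.indicator f'), ?_⟩
  have he := coe_ofFun (hfm.indicator hD.compl).aestronglyMeasurable
    (eLux_compl_indicator_norm_gt_lt_top (Φ := Φ) (m := m) hfin f' n)
  have hsub : (f - ((ofFun Φ m ({x | (n : ℝ) < ‖f' x‖}ᶜ.indicator f') : OrliczSpace Φ m) : G →ₘ[m] ℂ) :
      G → ℂ) =ᵐ[m]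
      {x | (n : ℝ) < ‖f' x‖}.indicator f' := by
    rw [Set.indicator_compl] at he ⊢
    filter_upwards [h, he] with x h1 h2
    rw [Pi.sub_apply, h1, h2, Pi.sub_apply, sub_sub_cancel]
  rw [vnorm_congr fun x' => ae_pairing hsub x']
  refine (hn.trans_eq ?_).trans_lt hηε
  rw [← ENNReal.coe_ofNat, ← ENNReal.coe_mul, mul_div_cancel₀ _ (by norm_num)]

end ConvolutionMeasure

end OrliczConv

end

theorem mainTheorem10 {G : Type*} [Group G] [TopologicalSpace G] [IsTopologicalGroup G]
    [CompactSpace G] [T2Space G] [MeasurableSpace G] [BorelSpace G]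
    (m : Measure G) [m.IsHaarMeasure] [m.Regular] [IsProbabilityMeasure m]
    (Φ : OrliczConv.YoungFunction) (hfin : ∀ x : ℝ≥0, Φ x ≠ ⊤)
    (hΦ : OrliczConv.DeltaTwo Φ)
    (hΨ : OrliczConv.DeltaTwo (OrliczConv.complementary Φ))
    (μ : ComplexMeasure G) (hreg : μ.variation.Regular) (hμ : μ Set.univ ≠ 0) :
    ∃ (T : OrliczConv.OrliczSpace Φ m →L[ℂ] OrliczConv.OrliczSpace Φ m)
      (ν : VectorMeasure G (OrliczConv.OrliczSpace Φ m)),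
      -- `T` is the convolution operator `f ↦ μ * f`
      (∀ f : OrliczConv.OrliczSpace Φ m,
        (∀ᵐ t ∂m, Integrable (fun s => (f : G →ₘ[m] ℂ) (s⁻¹ * t)) μ.variation) ∧
        (T f : G →ₘ[m] ℂ) =ᵐ[m] OrliczConv.conv μ (f : G →ₘ[m] ℂ)) ∧
      -- `ν` is the vector measure `A ↦ T(χ_A)` associated with `T`
      (∀ A, MeasurableSet A → ∃ c : OrliczConv.OrliczSpace Φ m,
        (c : G →ₘ[m] ℂ) =ᵐ[m] A.indicator 1 ∧ ν A = T c) ∧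
      -- `ν` and `m` have the same null sets, so classes modulo `ν` and modulo `m` agree
      (∀ A, MeasurableSet A → (OrliczConv.IsNull ν A ↔ m A = 0)) ∧
      -- the seminorm of `L¹(ν)` is finite
      (∀ f : G → ℂ, OrliczConv.MemL1 ν f → OrliczConv.vnorm ν f < ⊤) ∧
      -- `L^Φ(G)` is contained in `L¹(ν)` and dense there
      (∀ f : OrliczConv.OrliczSpace Φ m, OrliczConv.MemL1 ν (f : G →ₘ[m] ℂ)) ∧
      (∀ f : G → ℂ, OrliczConv.MemL1 ν f → ∀ ε : ℝ≥0∞, 0 < ε →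
        ∃ g : OrliczConv.OrliczSpace Φ m, OrliczConv.vnorm ν (f - (g : G →ₘ[m] ℂ)) < ε) ∧
      -- the integration operator is a continuous extension of `T` to `L¹(ν)` ...
      (∀ f : OrliczConv.OrliczSpace Φ m,
        OrliczConv.integrationOp ν (f : G →ₘ[m] ℂ) = T f) ∧
      (∀ f : G → ℂ, OrliczConv.MemL1 ν f →
        ‖OrliczConv.integrationOp ν f‖ₑ ≤ OrliczConv.vnorm ν f) ∧
      -- ... and is given by `f ↦ μ * f`
      (∀ f : G → ℂ, OrliczConv.MemL1 ν f →
        (∀ᵐ t ∂m, Integrable (fun s => f (s⁻¹ * t)) μ.variation) ∧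
        ((OrliczConv.integrationOp ν f : OrliczConv.OrliczSpace Φ m) : G →ₘ[m] ℂ) =ᵐ[m] OrliczConv.conv μ f) := by
  have := hreg
  refine ⟨OrliczConv.convOp m μ Φ hfin hμ,
    OrliczConv.operatorMeasure hfin hΦ (OrliczConv.convOp m μ Φ hfin hμ), fun f => ⟨?_, ?_⟩,
    fun A hA => ⟨OrliczConv.ofFun Φ m (A.indicator 1), ?_, OrliczConv.operatorMeasure_apply hA⟩,
    fun A hA => OrliczConv.isNull_convOp_iff hA, fun f hf => OrliczConv.vnorm_lt_top hf,
    fun f => OrliczConv.memL1_operatorMeasure (MeasureTheory.AEEqFun.stronglyMeasurable _)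
      (OrliczConv.eLux_coe_lt_top f),
    fun f hf ε hε => OrliczConv.exists_vnorm_sub_lt hf hε, fun f => ?_,
    fun f hf => OrliczConv.enorm_integrationOp_le hf,
    fun f hf => ⟨OrliczConv.ae_integrable_translates (OrliczConv.integrable_of_memL1 hf),
      OrliczConv.coe_integrationOp hf⟩⟩
  · exact OrliczConv.ae_integrable_translates (OrliczConv.integrable_of_eLux_lt_top
      (MeasureTheory.AEEqFun.aestronglyMeasurable _) (OrliczConv.eLux_coe_lt_top f))
  · exact OrliczConv.coe_convOp hfin hμ f
  · exact OrliczConv.coe_ofFun (OrliczConv.aestronglyMeasurable_indicator_one hA)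
      (OrliczConv.eLux_indicator_one_lt_top hfin A)
  · rw [OrliczConv.integrationOp_operatorMeasure (MeasureTheory.AEEqFun.stronglyMeasurable _)
      (OrliczConv.eLux_coe_lt_top f), OrliczConv.ofFun_coe]
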